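/- **Setting.** Let $(X_i,T_i,Y_i(0),Y_i(1))_{i\ge 1}$ be i.i.d. with $X_i\in\mathbb R^p$, $\mathbb E\|X\|^2<\infty$, binary treatment $T_i\in\{0,1\}$ and potential outcomes (losses) $Y_i(t)\in\mathbb R^k$. One observes $(X_i,T_i,Y_i)$ with $Y_i=Y_i(T_i)$. Assume * ignorability: $Y(t)\perp T\mid X$ for $t=0,1$; * overlap: the known propensity score $e_t(X)=P(T=t\mid X)$ satisfies $0<\eta\le e_t(x)<1$ for all $t,x$; * bounded outcomes: $|Y_j(t)|\le L$ almost surely for every $t$ and every coordinate $j$; * the reduced-rank model $\mathbb E[Y(t)\mid X]=A_tB_tX$ with $A_t\in\mathbb R^{k\times s}$, $B_t\in\mathbb R^{s\times p}$. Let $\rho\in\mathbb R^k$, let $\Pi$ be a finite class of $N$ policies $\pi(t\mid x)$, let $V_Y(\pi)=\mathbb E\big[\sum_t\pi(t\mid X)\rho^\top Y(t)\big]$, and let $\pi^*\in\Pi$ minimize $V_Y$ over $\Pi$. For weights $D_t$ and matrices $G_t$ put $C_t(G)=\big(1-\tfrac{\mathbb 1[T=t]}{e_t(X)}\big)G_tX$.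 Fix population weights $D^*_t\in\mathbb R^s$ (arbitrary; in particular they may be the variance-minimizing ones), put $$\phi(D^*;\pi)=\sum_t\pi(t\mid X)\Big\{\tfrac{\mathbb 1[T=t]\,\rho^\top Y}{e_t(X)}+D_t^{*\top}C_t(B)\Big\},$$ and assume $|\phi(D^*;\pi)|\le L$ almost surely for every $\pi\in\Pi$. From the first $n$ observations let $\hat A_t\in\mathbb R^{k\times r}$, $\hat B_t\in\mathbb R^{r\times p}$ be rank-$r$ reduced-rank regression fits, i.e. minimizers of $\sum_{i:T_i=t}\|Y_i-A'B'X_i\|^2$ over all $A'\in\mathbb R^{k\times r}$, $B'\in\mathbb R^{r\times p}$. Let the regression weight $\hat D_t$ be a least-squares solution of $\rho^\top\hat A_t\hat B_tX_i= C_{t,i}(\hat B)^\top D$ over $i\le n$ (so $\hat D_t=(C_t^\top C_t)^{-1}C_t^\top(\rho^\top\hat\mu_t)$ when the inverse exists, with $\hat\mu_t=\hat A_t\hat B_tX$). The denoised control-variate estimators with population and with estimated weights are $$\hat V^{*}(\pi)=\sum_t\mathbb E_n\Big[\pi(t\mid X)\Big\{\tfrac{\mathbb 1[T=t]\rho^\top\hat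 A_t\hat B_tX}{e_t(X)}+D_t^{*\top}C_t(B)\Big\}\Big],\qquad \hat V(\pi)=\sum_t\mathbb E_n\Big[\pi(t\mid X)\Big\{\tfrac{\mathbb 1[T=t]\rho^\top\hat A_t\hat B_tX}{e_t(X)}+\hat D_t^{\top}C_t(\hat B)\Big\}\Big].$$ Put $$\mathrm{Bern}_n(\delta)=\sqrt{2\log\Big(\frac{2N}{\delta}\Big)\frac{\sup_{\pi\in\Pi}\mathrm{Var}[\phi(D^*;\pi)]}{n}}+\frac{2L}{3n}\log\Big(\frac{2N}{\delta}\Big),$$ $$\mathrm{RRR}_n=\sqrt{\frac2n}\,\Big\{\sum_t\Big(C_1\sum_{j>r}d_j^2(A_tB_tX_{(t)})+C_2\,r\,d_1^2(P_tE_t)\Big)\Big\}^{1/2},$$ where $X_{(t)}$ is the covariate matrix (columns are units) of the units with $T_i=t$, $E_t$ is the matrix (rows are units) of the residuals $Y_i-A_tB_tX_i$ over these units, $P_t$ is the orthogonal projection onto the column space of $X_{(t)}^\top$, and $d_1\ge d_2\ge\dots$ are singular values. Put $\Delta_n=\max_{\pi\in\Pi}|\hat V(\pi)-\hat V^*(\pi)|$,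 the effect of estimating the weights. **Theorem (Generalization error).** There are constants $C_1,C_2>0$, depending only on $\rho$ and $\eta$, such that in every such setting the following hold. 1. If $\hat\pi_n$ minimizes $\hat V^*$ over $\Pi$ then, for every $n\ge1$ and $\delta\in(0,1)$, with probability at least $1-\delta$, $$|\hat V^*(\hat\pi_n)-V_Y(\pi^*)|\le \mathrm{Bern}_n(\delta)+\mathrm{RRR}_n\quad\text{and}\quad V_Y(\hat\pi_n)-V_Y(\pi^*)\le 2\big(\mathrm{Bern}_n(\delta)+\mathrm{RRR}_n\big).$$ 2. If $\hat\pi_n$ minimizes $\hat V$ over $\Pi$, the same holds with $\hat V$ in place of $\hat V^*$ and $\mathrm{RRR}_n+\Delta_n$ in place of $\mathrm{RRR}_n$. 3. $\Delta_n=O_p(n^{-1/2})$, and if $\operatorname{rank}(A_tB_t)\le r$ for $t=0,1$ then $\mathrm{RRR}_n=O_p(n^{-1/2})$. -/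

import Mathlib

open MeasureTheory ProbabilityTheory Filter Matrix
open scoped Topology ENNReal

universe u

noncomputable section

namespace RRPolicy

/-- A (stochastic) policy on `ℝᵖ` for a binary treatment: `π.prob t x` is `π(t ∣ x)`. -/
structure Policy (p : ℕ) where
  prob : Fin 2 → (Fin p → ℝ) → ℝ
  measurable_prob : ∀ t, Measurable (prob t)
  nonneg : ∀ t x, 0 ≤ prob t x
  sum_eq_one : ∀ x, ∑ t, prob t x = 1

/-- One observed unit `(X, T, Y)`. -/
structure Obs (p k : ℕ) where
  x : Fin p → ℝ
  t : Fin 2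
  y : Fin k → ℝ

/-- `𝟙[T = t]`. -/
def ind (T t : Fin 2) : ℝ := if T = t then 1 else 0

/-- The control variate vector `C_t(h, X) = (1 - 𝟙[T = t] / e_t(X)) h_t(X)` with `h_t(x) = G_t x`. -/
def controlVariate {p k q : ℕ} (e : Fin 2 → (Fin p → ℝ) → ℝ)
    (G : Fin 2 → Matrix (Fin q) (Fin p) ℝ) (t : Fin 2) (o : Obs p k) : Fin q → ℝ :=
  (1 - ind o.t t / e t o.x) • (G t *ᵥ o.x)

/-- `φ(D; π) = ∑_t π(t ∣ X) { 𝟙[T = t] m_t / e_t(X) + D_tᵀ C_t }`, where `m_t` is the scalarized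
outcome that is plugged in (either `ρᵀ Y` or its denoised version). -/
def phi {p k q : ℕ} (e : Fin 2 → (Fin p → ℝ) → ℝ) (G : Fin 2 → Matrix (Fin q) (Fin p) ℝ)
    (D : Fin 2 → Fin q → ℝ) (m : Fin 2 → Obs p k → ℝ) (π : Policy p) (o : Obs p k) : ℝ :=
  ∑ t, π.prob t o.x * (ind o.t t * m t o / e t o.x + D t ⬝ᵥ controlVariate e G t o)

/-- The observed scalarized outcome `ρᵀ Y`. -/
def observedScore {p k : ℕ} (ρ : Fin k → ℝ) (_t : Fin 2) (o : Obs p k) : ℝ := ρ ⬝ᵥ o.y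

/-- The denoised scalarized outcome `ρᵀ Â_t B̂_t X`. -/
def denoisedScore {p k r : ℕ} (ρ : Fin k → ℝ) (Ahat : Fin 2 → Matrix (Fin k) (Fin r) ℝ)
    (Bhat : Fin 2 → Matrix (Fin r) (Fin p) ℝ) (t : Fin 2) (o : Obs p k) : ℝ :=
  ρ ⬝ᵥ ((Ahat t * Bhat t) *ᵥ o.x)

/-- The denoised control-variate estimator
`∑_t 𝔼_n[ π(t ∣ X) { 𝟙[T = t] ρᵀ Â_t B̂_t X / e_t(X) + D_tᵀ C_t } ]`, with
`C_t = (1 - 𝟙[T = t] / e_t(X)) G_t X`. -/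
def cvEstimator {p k r q n : ℕ} (ρ : Fin k → ℝ) (e : Fin 2 → (Fin p → ℝ) → ℝ)
    (Ahat : Fin 2 → Matrix (Fin k) (Fin r) ℝ) (Bhat : Fin 2 → Matrix (Fin r) (Fin p) ℝ)
    (G : Fin 2 → Matrix (Fin q) (Fin p) ℝ) (D : Fin 2 → Fin q → ℝ)
    (S : Fin n → Obs p k) (π : Policy p) : ℝ :=
  (∑ i, phi e G D (denoisedScore ρ Ahat Bhat) π (S i)) / n

/-- `(Â_t, B̂_t)_t` is a rank-`r` reduced-rank regression fit: in each treatment arm it is a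
least-squares fit among all products of a `k × r` and an `r × p` matrix. -/
def IsRRRFit {p k r n : ℕ} (S : Fin n → Obs p k) (Ahat : Fin 2 → Matrix (Fin k) (Fin r) ℝ)
    (Bhat : Fin 2 → Matrix (Fin r) (Fin p) ℝ) : Prop :=
  ∀ t, ∀ (A' : Matrix (Fin k) (Fin r) ℝ) (B' : Matrix (Fin r) (Fin p) ℝ),
    ∑ i, ind (S i).t t * ∑ j, ((S i).y j - ((Ahat t * Bhat t) *ᵥ (S i).x) j) ^ 2 ≤
      ∑ i, ind (S i).t t * ∑ j, ((S i).y j - ((A' * B') *ᵥ (S i).x) j) ^ 2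

/-- `D̂_t` is a regression control-variate weight: a least-squares solution of
`ρᵀ μ̂_t = C_t D̂_t`, where the rows of `C_t` are the control variates `C_t(B̂_t X, X)` of the sample
and `μ̂_t = Â_t B̂_t X`. It equals `(C_tᵀ C_t)⁻¹ C_tᵀ (ρᵀ μ̂_t)` whenever `C_tᵀ C_t` is invertible. -/
def IsRegressionWeight {p k r n : ℕ} (ρ : Fin k → ℝ) (e : Fin 2 → (Fin p → ℝ) → ℝ)
    (Ahat : Fin 2 → Matrix (Fin k) (Fin r) ℝ) (Bhat : Fin 2 → Matrix (Fin r) (Fin p) ℝ)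
    (S : Fin n → Obs p k) (Dhat : Fin 2 → Fin r → ℝ) : Prop :=
  ∀ t, ∀ D' : Fin r → ℝ,
    ∑ i, (denoisedScore ρ Ahat Bhat t (S i) - controlVariate e Bhat t (S i) ⬝ᵥ Dhat t) ^ 2 ≤
      ∑ i, (denoisedScore ρ Ahat Bhat t (S i) - controlVariate e Bhat t (S i) ⬝ᵥ D') ^ 2

/-- The singular value `d_{j+1}(M)` (indexed from `0`, in decreasing order). -/
def singVal {a b : ℕ} (M : Matrix (Fin a) (Fin b) ℝ) (j : ℕ) : ℝ :=
  (Matrix.toEuclideanLin M).singularValues j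

/-- Covariate matrix of arm `t`: row `i` is `X_i` if `T_i = t`. The units of the other arm give zero
rows; these change neither singular values nor residual norms. -/
def armDesign {p k n : ℕ} (S : Fin n → Obs p k) (t : Fin 2) : Matrix (Fin n) (Fin p) ℝ :=
  Matrix.of fun i a => ind (S i).t t * (S i).x a

/-- Outcome matrix of arm `t` (rows are units; zero rows for the other arm). -/
def armOutcome {p k n : ℕ} (S : Fin n → Obs p k) (t : Fin 2) : Matrix (Fin n) (Fin k) ℝ :=
  Matrix.of fun i j => ind (S i).t t * (S i).y j

/-- Noise matrix of arm `t`, `E = Y - X Mᵀ`, for the coefficient matrix `M`. -/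
def armNoise {p k n : ℕ} (S : Fin n → Obs p k) (M : Matrix (Fin k) (Fin p) ℝ) (t : Fin 2) :
    Matrix (Fin n) (Fin k) ℝ :=
  armOutcome S t - armDesign S t * Mᵀ

/-- The matrix of the orthogonal projection of `ℝⁿ` onto the column space of `X`. -/
def columnProj {n p : ℕ} (X : Matrix (Fin n) (Fin p) ℝ) : Matrix (Fin n) (Fin n) ℝ :=
  Matrix.toEuclideanLin.symm
    ((LinearMap.range (Matrix.toEuclideanLin X)).starProjection :
      EuclideanSpace ℝ (Fin n) →ₗ[ℝ] EuclideanSpace ℝ (Fin n))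

/-- The reduced-rank-regression prediction-error term
`√(2/n) { ∑_t ( C₁ ∑_{j>r} d_j²(A_t B_t X) + C₂ r d_1²(P_t E_t) ) }^{1/2}`. -/
def rrrTerm {p k s n : ℕ} (C₁ C₂ : ℝ) (r : ℕ) (A : Fin 2 → Matrix (Fin k) (Fin s) ℝ)
    (B : Fin 2 → Matrix (Fin s) (Fin p) ℝ) (S : Fin n → Obs p k) : ℝ :=
  √(2 / n) * √(∑ t,
    (C₁ * ∑ j ∈ Finset.Ico r k, singVal (A t * B t * (armDesign S t)ᵀ) j ^ 2 +
      C₂ * r * singVal (columnProj (armDesign S t) * armNoise S (A t * B t) t) 0 ^ 2))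

/-- The Bernstein term `√(2 log(2N/δ) v / n) + (2L / 3n) log(2N/δ)`. -/
def bernsteinTerm (N n : ℕ) (δ v L : ℝ) : ℝ :=
  √(2 * Real.log (2 * N / δ) * (v / n)) + 2 * L / (3 * n) * Real.log (2 * N / δ)

/-- `R_n = O_p(a_n)`. -/
def IsBigOP {Ω : Type u} [MeasurableSpace Ω] (μ : Measure Ω) (R : ℕ → Ω → ℝ) (a : ℕ → ℝ) : Prop :=
  ∀ ε : ℝ, 0 < ε → ∃ M : ℝ, ∀ᶠ n in atTop, μ {ω | M * a n < |R n ω|} ≤ ENNReal.ofReal ε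

/-- Unit `i` as observed: `(X_i, T_i, Y_i(T_i))`. -/
def observed {Ω : Type u} {p k : ℕ} (X : ℕ → Ω → Fin p → ℝ) (T : ℕ → Ω → Fin 2)
    (Y : Fin 2 → ℕ → Ω → Fin k → ℝ) (i : ℕ) (ω : Ω) : Obs p k :=
  ⟨X i ω, T i ω, Y (T i ω) i ω⟩

/-- The observed sample of size `n`. -/
def sample {Ω : Type u} {p k : ℕ} (X : ℕ → Ω → Fin p → ℝ) (T : ℕ → Ω → Fin 2)
    (Y : Fin 2 → ℕ → Ω → Fin k → ℝ) (n : ℕ) (ω : Ω) : Fin n → Obs p k :=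
  fun i => observed X T Y i ω

/-- The policy value `V_Y(π) = 𝔼[∑_t π(t ∣ X) ρᵀ Y(t)]`. -/
def policyValue {Ω : Type u} [MeasurableSpace Ω] {p k : ℕ} (μ : Measure Ω) (ρ : Fin k → ℝ)
    (X : ℕ → Ω → Fin p → ℝ) (Y : Fin 2 → ℕ → Ω → Fin k → ℝ) (π : Policy p) : ℝ :=
  ∫ ω, ∑ t, π.prob t (X 0 ω) * (ρ ⬝ᵥ Y t 0 ω) ∂μ

/-- The data-generating model: i.i.d. units `(X_i, T_i, (Y_i(0), Y_i(1)))`, propensity score `e`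
with overlap level `η`, ignorability, outcomes bounded by `L`, and the reduced-rank outcome model
`Y(t) = A_t B_t X + noise` with conditionally mean-zero noise. -/
structure IsModel {Ω : Type u} [MeasurableSpace Ω] {p k s : ℕ} (μ : Measure Ω)
    (X : ℕ → Ω → Fin p → ℝ) (T : ℕ → Ω → Fin 2) (Y : Fin 2 → ℕ → Ω → Fin k → ℝ)
    (e : Fin 2 → (Fin p → ℝ) → ℝ) (A : Fin 2 → Matrix (Fin k) (Fin s) ℝ)
    (B : Fin 2 → Matrix (Fin s) (Fin p) ℝ) (η L : ℝ) : Prop where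
  measurable_X : ∀ i, Measurable (X i)
  measurable_T : ∀ i, Measurable (T i)
  measurable_Y : ∀ t i, Measurable (Y t i)
  indep : iIndepFun (fun i ω => (X i ω, T i ω, fun t => Y t i ω)) μ
  identDistrib : ∀ i, IdentDistrib (fun ω => (X i ω, T i ω, fun t => Y t i ω))
    (fun ω => (X 0 ω, T 0 ω, fun t => Y t 0 ω)) μ μ
  memLp_X : MemLp (X 0) 2 μ
  measurable_e : ∀ t, Measurable (e t)
  /-- `e_t(X) = P(T = t ∣ X)` -/
  propensity : ∀ t, (fun ω => e t (X 0 ω)) =ᵐ[μ]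
    μ[fun ω => ind (T 0 ω) t | MeasurableSpace.comap (X 0) inferInstance]
  overlap : ∀ t x, η ≤ e t x ∧ e t x < 1
  /-- `Y(t) ⫫ T ∣ X`, in the form `P(T = t ∣ X, Y(t)) = P(T = t ∣ X)` -/
  ignorability : ∀ t,
    μ[fun ω => ind (T 0 ω) t |
      MeasurableSpace.comap (X 0) inferInstance ⊔ MeasurableSpace.comap (Y t 0) inferInstance]
    =ᵐ[μ] μ[fun ω => ind (T 0 ω) t | MeasurableSpace.comap (X 0) inferInstance]
  outcome_model : ∀ t,
    μ[Y t 0 | MeasurableSpace.comap (X 0) inferInstance]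
    =ᵐ[μ] fun ω => (A t * B t) *ᵥ X 0 ω
  bounded : ∀ t, ∀ᵐ ω ∂μ, ∀ j, |Y t 0 ω j| ≤ L

end RRPolicy

end

/-! ### Singular values and low-rank approximation -/

namespace LinearMap

variable {E F : Type*} [NormedAddCommGroup E] [InnerProductSpace ℝ E] [FiniteDimensional ℝ E]
  [NormedAddCommGroup F] [InnerProductSpace ℝ F] [FiniteDimensional ℝ F]

/-! Three estimators of the policy value are compared. `V̂*` plugs in the fitted means `Â_t B̂_t X`;
an oracle version plugs in the true means `A_t B_t X` with the same control variates; the score `φ`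
uses the observed outcomes.

The oracle score is `E[φ | X, T]` (`condExp_phi`): ignorability and the outcome model make the
inverse-propensity-weighted noise centred given `(X, T)`. Hence it has mean `V_Y(π)`, inherits the
bound `L`, and has no more variance than `φ`. Bernstein's inequality and a union bound over the `N`
policies give `Bern_n`.

The fits depend on the sample, so `V̂*` is not an average of independent terms. Its distance to the
oracle estimator is instead bounded for every sample (`abs_cvEstimator_sub_le`): the control
variates cancel, Cauchy-Schwarz and overlap leave the in-sample prediction error, and the oracle
inequality `frobSq_reducedRank_le` bounds that by `RRR_n`. A uniform deviation bound then yields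
both claims about the minimizer, and replacing `D*` by `D̂` costs at most `Δ_n`.

For the rates, the weights enter only through the inner products of `B_tᵀ D_t` with averages of
`π(t|X)(1 - 𝟙[T=t]/e_t) X`. These averages are centred with finite variance, hence `O_p(n^{-1/2})`,
so boundedness of the projection of `B̂_tᵀ D̂_t` to the support subspace of `X` suffices. It follows
on the event, of probability tending to one, where the second-moment form of each arm is bounded
below (`exists_gram_bound`). On that event `d_1(P_t E_t)` is likewise at most a constant times `√n`
times a sum of absolute covariate-noise averages, while the rank condition removes the
singular-value tail. -/

theorem inner_apply_eigenvectorBasis (T : E →ₗ[ℝ] F) (i : Fin (Module.finrank ℝ E)) (v : E) :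
    inner ℝ (T (T.isSymmetric_adjoint_comp_self.eigenvectorBasis rfl i)) (T v) =
      T.singularValues i ^ 2 *
        inner ℝ (T.isSymmetric_adjoint_comp_self.eigenvectorBasis rfl i) v := by
  have h := T.isSymmetric_adjoint_comp_self.apply_eigenvectorBasis rfl i
  rw [← LinearMap.adjoint_inner_left, ← LinearMap.comp_apply, h, T.sq_singularValues_fin rfl i,
    real_inner_smul_left]
  rfl

theorem norm_sq_apply_eigenvectorBasis (T : E →ₗ[ℝ] F) (i : Fin (Module.finrank ℝ E)) :
    ‖T (T.isSymmetric_adjoint_comp_self.eigenvectorBasis rfl i)‖ ^ 2 = T.singularValues i ^ 2 := by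
  rw [← real_inner_self_eq_norm_sq, inner_apply_eigenvectorBasis, real_inner_self_eq_norm_sq]
  simp

theorem norm_apply_le_singularValues_zero_mul (T : E →ₗ[ℝ] F) (v : E) :
    ‖T v‖ ≤ T.singularValues 0 * ‖v‖ := by
  refine le_of_sq_le_sq ?_ (mul_nonneg (T.singularValues_nonneg 0) (norm_nonneg _))
  set b := T.isSymmetric_adjoint_comp_self.eigenvectorBasis rfl
  have h1 : ‖T v‖ ^ 2 =
      ∑ i : Fin (Module.finrank ℝ E), T.singularValues i ^ 2 * inner ℝ (b i) v ^ 2 := by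
    rw [← real_inner_self_eq_norm_sq]
    nth_rewrite 1 [← b.sum_repr' v]
    rw [map_sum, sum_inner]
    refine Finset.sum_congr rfl fun i _ => ?_
    rw [map_smul, real_inner_smul_left, inner_apply_eigenvectorBasis]
    ring
  rw [h1, mul_pow, ← b.sum_sq_inner_right v, Finset.mul_sum]
  refine Finset.sum_le_sum fun i _ => ?_
  have := T.singularValues_antitone (Nat.zero_le i)
  have h0 := T.singularValues_nonneg i
  gcongr

theorem singularValues_zero_le_of_norm_apply_le (T : E →ₗ[ℝ] F) {c : ℝ} (hc : 0 ≤ c)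
    (h : ∀ v, ‖T v‖ ≤ c * ‖v‖) : T.singularValues 0 ≤ c := by
  rcases Nat.eq_zero_or_pos (Module.finrank ℝ E) with h0 | h0
  · rw [T.singularValues_of_finrank_le h0.le]
    exact hc
  · refine le_of_sq_le_sq ?_ hc
    have := T.norm_sq_apply_eigenvectorBasis ⟨0, h0⟩
    simp only at this
    rw [← this]
    have h2 := h (T.isSymmetric_adjoint_comp_self.eigenvectorBasis rfl ⟨0, h0⟩)
    rw [OrthonormalBasis.norm_eq_one, mul_one] at h2
    gcongr

/-- Both sides are the trace of `S* S`; this lets the Frobenius norm be computed in the basis of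
right singular vectors. -/
theorem sum_norm_sq_apply_orthonormalBasis {ι κ : Type*} [Fintype ι] [Fintype κ]
    (S : E →ₗ[ℝ] F) (b : OrthonormalBasis ι ℝ E) (c : OrthonormalBasis κ ℝ E) :
    ∑ i, ‖S (b i)‖ ^ 2 = ∑ i, ‖S (c i)‖ ^ 2 := by
  have hS : ∀ v, ‖S v‖ ^ 2 = inner ℝ v ((S.adjoint ∘ₗ S) v) := fun v => by
    rw [LinearMap.comp_apply, LinearMap.adjoint_inner_right, real_inner_self_eq_norm_sq]
  simp only [hS]
  rw [← LinearMap.trace_eq_sum_inner _ b, ← LinearMap.trace_eq_sum_inner _ c]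

/-- Upper bound in the Eckart-Young theorem: some projection onto the span of `r` vectors leaves a
remainder whose squared Frobenius norm is the sum of the remaining squared singular values. -/
theorem exists_span_sum_norm_sq_sub_starProjection_le {ι : Type*} [Fintype ι] (T : E →ₗ[ℝ] F)
    (r : ℕ) (c : OrthonormalBasis ι ℝ E) :
    ∃ W : Fin r → F,
      ∑ i, ‖T (c i) - (Submodule.span ℝ (Set.range W)).starProjection (T (c i))‖ ^ 2 ≤
        ∑ j ∈ Finset.Ico r (Module.finrank ℝ F), T.singularValues j ^ 2 := by
  set b := T.isSymmetric_adjoint_comp_self.eigenvectorBasis rfl with hb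
  -- The vectors are the images of the top `r` right singular vectors, padded with `0` when `r`
  -- exceeds the dimension of the domain.
  refine ⟨fun j => if h : (j : ℕ) < Module.finrank ℝ E then T (b ⟨j, h⟩) else 0, ?_⟩
  set U := Submodule.span ℝ (Set.range
    fun j : Fin r => if h : (j : ℕ) < Module.finrank ℝ E then T (b ⟨j, h⟩) else 0) with hU
  set S : E →ₗ[ℝ] F := T - (U.starProjection : F →ₗ[ℝ] F) ∘ₗ T with hS
  have h1 := S.sum_norm_sq_apply_orthonormalBasis c b
  have h2 : ∀ v, S v = T v - U.starProjection (T v) := fun v => rfl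
  simp only [h2] at h1
  rw [h1]
  have h3 : ∀ i : Fin (Module.finrank ℝ E), ‖T (b i) - U.starProjection (T (b i))‖ ^ 2 ≤
      if (i : ℕ) < r then 0 else T.singularValues i ^ 2 := by
    intro i
    split_ifs with hi
    · have : T (b i) ∈ U := by
        refine Submodule.subset_span ⟨⟨i, hi⟩, ?_⟩
        simp
      rw [Submodule.starProjection_eq_self_iff.2 this]
      simp
    · rw [← T.norm_sq_apply_eigenvectorBasis i, ← hb]
      have := Submodule.norm_sq_eq_add_norm_sq_starProjection (T (b i)) U
      rw [Submodule.starProjection_orthogonal_val] at this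
      nlinarith [sq_nonneg ‖U.starProjection (T (b i))‖]
  refine (Finset.sum_le_sum fun i _ => h3 i).trans ?_
  rw [Fin.sum_univ_eq_sum_range (fun i => if i < r then 0 else T.singularValues i ^ 2)]
  rw [Finset.sum_ite, Finset.sum_const_zero, zero_add]
  -- The left sum runs up to `dim E`, the right one up to `dim F`; a nonzero singular value has
  -- index below the rank, which is at most `dim F`.
  rw [← Finset.sum_filter_ne_zero]
  refine Finset.sum_le_sum_of_subset_of_nonneg (fun j hj' => ?_) fun _ _ _ => sq_nonneg _
  obtain ⟨hj, hne⟩ := Finset.mem_filter.1 hj'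
  have hpos : 0 < T.singularValues j :=
    lt_of_le_of_ne (T.singularValues_nonneg j) fun h => hne (by rw [← h]; simp)
  rw [T.singularValues_pos_iff_lt_finrank_range] at hpos
  have := Submodule.finrank_le (LinearMap.range T)
  simp at hj ⊢
  omega

end LinearMap

/-! ### Oracle inequality for reduced-rank regression. -/

namespace RRPolicy

/-- The squared Frobenius norm. -/
def frobSq {a b : ℕ} (Z : Matrix (Fin a) (Fin b) ℝ) : ℝ := ∑ i, ∑ j, Z i j ^ 2

theorem frobSq_nonneg {a b : ℕ} (Z : Matrix (Fin a) (Fin b) ℝ) : 0 ≤ frobSq Z :=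
  Finset.sum_nonneg fun _ _ => Finset.sum_nonneg fun _ _ => sq_nonneg _

theorem singVal_nonneg {a b : ℕ} (M : Matrix (Fin a) (Fin b) ℝ) (j : ℕ) : 0 ≤ singVal M j :=
  LinearMap.singularValues_nonneg _ _

theorem frobSq_sub {a b : ℕ} (Z W : Matrix (Fin a) (Fin b) ℝ) :
    frobSq (Z - W) = frobSq Z - 2 * (∑ i, ∑ j, Z i j * W i j) + frobSq W := by
  simp only [frobSq, Matrix.sub_apply, Finset.mul_sum, ← Finset.sum_sub_distrib,
    ← Finset.sum_add_distrib]
  exact Finset.sum_congr rfl fun i _ => Finset.sum_congr rfl fun j _ => by ring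

theorem toEuclideanLin_columnProj {n p : ℕ} (X : Matrix (Fin n) (Fin p) ℝ)
    (v : EuclideanSpace ℝ (Fin n)) :
    Matrix.toEuclideanLin (columnProj X) v =
      (LinearMap.range (Matrix.toEuclideanLin X)).starProjection v := by
  simp [columnProj]

theorem toEuclideanLin_mul_apply {a b c : ℕ} (M : Matrix (Fin a) (Fin b) ℝ)
    (N : Matrix (Fin b) (Fin c) ℝ) (v : EuclideanSpace ℝ (Fin c)) :
    Matrix.toEuclideanLin (M * N) v = Matrix.toEuclideanLin M (Matrix.toEuclideanLin N v) := by
  simp [Matrix.toEuclideanLin]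

/-- The trace of `Eᵀ Z` only sees the span `R` of the rows of `Z`. Having `dim R` terms instead of
`k` is what later produces a factor `√(rank)`. -/
theorem frobInner_eq_sum_inner {n k : ℕ} {ι : Type*} [Fintype ι]
    (E Z : Matrix (Fin n) (Fin k) ℝ) (R : Submodule ℝ (EuclideanSpace ℝ (Fin k)))
    (b : OrthonormalBasis ι ℝ R) (hZ : ∀ i, WithLp.toLp 2 (Z i) ∈ R) :
    ∑ i, ∑ j, E i j * Z i j =
      ∑ l, inner ℝ (Matrix.toEuclideanLin E (b l)) (Matrix.toEuclideanLin Z (b l)) := by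
  have h1 : ∀ (M : Matrix (Fin n) (Fin k) ℝ) (v : EuclideanSpace ℝ (Fin k)) (i : Fin n),
      (Matrix.toEuclideanLin M v) i = inner ℝ (WithLp.toLp 2 (M i)) v := by
    intro M v i
    simp [Matrix.toEuclideanLin, Matrix.mulVec, dotProduct, PiLp.inner_apply, mul_comm]
  have h2 : ∀ i, ∑ j, E i j * Z i j =
      ∑ l, inner ℝ (WithLp.toLp 2 (E i)) (b l : EuclideanSpace ℝ (Fin k)) *
        inner ℝ (WithLp.toLp 2 (Z i)) (b l : EuclideanSpace ℝ (Fin k)) := by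
    intro i
    have h3 := congrArg (Subtype.val) (b.sum_repr' ⟨_, hZ i⟩)
    simp only [Submodule.coe_sum, Submodule.coe_smul, Submodule.coe_inner] at h3
    have h4 : ∑ j, E i j * Z i j = inner ℝ (WithLp.toLp 2 (E i)) (WithLp.toLp 2 (Z i)) := by
      simp [PiLp.inner_apply, mul_comm]
    rw [h4]
    nth_rewrite 1 [← h3]
    rw [inner_sum]
    refine Finset.sum_congr rfl fun l _ => ?_
    rw [real_inner_smul_right, real_inner_comm, mul_comm, real_inner_comm]
  simp only [h2]
  rw [Finset.sum_comm]
  refine Finset.sum_congr rfl fun l _ => ?_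
  rw [PiLp.inner_apply]
  refine Finset.sum_congr rfl fun i _ => ?_
  rw [h1, h1]
  simp [mul_comm]

/-- Trace duality between the operator norm of the projected noise and a low-rank fit. -/
theorem frobInner_le_singVal_mul {n k p q : ℕ} (X : Matrix (Fin n) (Fin p) ℝ)
    (E : Matrix (Fin n) (Fin k) ℝ) (N : Matrix (Fin k) (Fin p) ℝ) (hN : N.rank ≤ q) :
    ∑ i, ∑ j, E i j * (X * Nᵀ) i j ≤
      singVal (columnProj X * E) 0 * (√q * √(frobSq (X * Nᵀ))) := by
  set R := LinearMap.range (Matrix.toEuclideanLin N)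
  set Z := X * Nᵀ
  set b := stdOrthonormalBasis ℝ R
  have hR : Module.finrank ℝ R ≤ q := by
    rw [Matrix.rank_eq_finrank_range_toLin N (PiLp.basisFun 2 ℝ (Fin k))
      (PiLp.basisFun 2 ℝ (Fin p))] at hN
    rw [← Matrix.toLpLin_eq_toLin] at hN
    exact hN
  have hZ : ∀ i, WithLp.toLp 2 (Z i) ∈ R := by
    intro i
    refine ⟨WithLp.toLp 2 (X i), ?_⟩
    ext j
    simp [Matrix.toEuclideanLin, Z, Matrix.mul_apply, Matrix.mulVec, dotProduct, mul_comm]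
  set d := singVal (columnProj X * E) 0
  have hd : 0 ≤ d := singVal_nonneg _ _
  rw [frobInner_eq_sum_inner E Z R b hZ]
  have h1 : ∀ l, inner ℝ (Matrix.toEuclideanLin E (b l)) (Matrix.toEuclideanLin Z (b l)) ≤
      d * ‖Matrix.toEuclideanLin Z (b l)‖ := by
    intro l
    have hmem : Matrix.toEuclideanLin Z (b l) ∈ LinearMap.range (Matrix.toEuclideanLin X) := by
      rw [toEuclideanLin_mul_apply]
      exact ⟨_, rfl⟩
    -- The columns of `Z = X Nᵀ` lie in the range of `X`, so the noise may be projected there for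
    -- free.
    have h2 : inner ℝ (Matrix.toEuclideanLin E (b l)) (Matrix.toEuclideanLin Z (b l)) =
        inner ℝ (Matrix.toEuclideanLin (columnProj X * E) (b l))
          (Matrix.toEuclideanLin Z (b l)) := by
      rw [toEuclideanLin_mul_apply (columnProj X), toEuclideanLin_columnProj,
        Submodule.inner_starProjection_left_eq_right,
        Submodule.starProjection_eq_self_iff.2 hmem]
    rw [h2]
    refine (real_inner_le_norm _ _).trans ?_
    have h3 := LinearMap.norm_apply_le_singularValues_zero_mul
      (Matrix.toEuclideanLin (columnProj X * E)) (b l)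
    have h4 : ‖(b l : EuclideanSpace ℝ (Fin k))‖ = 1 := by
      rw [← Submodule.coe_norm, b.norm_eq_one]
    rw [h4, mul_one] at h3
    gcongr
    exact h3
  have h5 : ∑ l, ‖Matrix.toEuclideanLin Z (b l)‖ ^ 2 = frobSq Z := by
    have := frobInner_eq_sum_inner Z Z R b hZ
    simp only [real_inner_self_eq_norm_sq] at this
    rw [← this, frobSq]
    simp only [pow_two]
  calc _ ≤ ∑ l, d * ‖Matrix.toEuclideanLin Z (b l)‖ := Finset.sum_le_sum fun l _ => h1 l
    _ = d * ∑ l, 1 * ‖Matrix.toEuclideanLin Z (b l)‖ := by simp [Finset.mul_sum]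
    _ ≤ d * (√(∑ l : Fin (Module.finrank ℝ R), (1 : ℝ) ^ 2) *
          √(∑ l, ‖Matrix.toEuclideanLin Z (b l)‖ ^ 2)) := by
        gcongr
        exact Real.sum_mul_le_sqrt_mul_sqrt _ _ _
    _ ≤ _ := by
        rw [h5]
        gcongr
        simpa using hR

/-- Oracle inequality for reduced-rank regression. -/
theorem frobSq_reducedRank_le {n k p r : ℕ} (X : Matrix (Fin n) (Fin p) ℝ)
    (Y : Matrix (Fin n) (Fin k) ℝ) (M : Matrix (Fin k) (Fin p) ℝ)
    (Ah : Matrix (Fin k) (Fin r) ℝ) (Bh : Matrix (Fin r) (Fin p) ℝ)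
    (hfit : ∀ (A' : Matrix (Fin k) (Fin r) ℝ) (B' : Matrix (Fin r) (Fin p) ℝ),
      frobSq (Y - X * (Ah * Bh)ᵀ) ≤ frobSq (Y - X * (A' * B')ᵀ)) :
    frobSq (X * (Ah * Bh - M)ᵀ) ≤ 3 * ∑ j ∈ Finset.Ico r k, singVal (M * Xᵀ) j ^ 2 +
      16 * r * singVal (columnProj X * (Y - X * Mᵀ)) 0 ^ 2 := by
  obtain ⟨W, hW⟩ := LinearMap.exists_span_sum_norm_sq_sub_starProjection_le
    (Matrix.toEuclideanLin (M * Xᵀ)) r (EuclideanSpace.basisFun (Fin n) ℝ)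
  rw [finrank_euclideanSpace, Fintype.card_fin] at hW
  set U := Submodule.span ℝ (Set.range W)
  -- The competitor must have the form `A' B' Xᵀ`. Eckart-Young for `M Xᵀ` provides this because it
  -- projects on the left: `U (M Xᵀ) = (U M) Xᵀ`, and `U M` factors through the `r` vectors `W`.
  have hB : ∀ a : Fin p, ∃ c : Fin r → ℝ,
      ∑ l, c l • W l = U.starProjection (Matrix.toEuclideanLin M (EuclideanSpace.single a 1)) :=
    fun a => (Submodule.mem_span_range_iff_exists_fun ℝ).1 (Submodule.starProjection_apply_mem _ _)
  choose c hc using hB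
  set A' : Matrix (Fin k) (Fin r) ℝ := Matrix.of fun j l => W l j
  set B' : Matrix (Fin r) (Fin p) ℝ := Matrix.of fun l a => c a l
  have hAB : ∀ v, Matrix.toEuclideanLin (A' * B') v =
      U.starProjection (Matrix.toEuclideanLin M v) := by
    intro v
    have : Matrix.toEuclideanLin (A' * B') =
        (U.starProjection : EuclideanSpace ℝ (Fin k) →ₗ[ℝ] EuclideanSpace ℝ (Fin k)) ∘ₗ
          Matrix.toEuclideanLin M := by
      refine (EuclideanSpace.basisFun (Fin p) ℝ).toBasis.ext fun a => ?_
      simp only [OrthonormalBasis.coe_toBasis, EuclideanSpace.basisFun_apply,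
        LinearMap.comp_apply, ContinuousLinearMap.coe_coe]
      rw [← hc a]
      ext j
      simp [Matrix.toEuclideanLin, A', B', Matrix.mulVec, dotProduct, mul_comm]
    rw [this]
    rfl
  set D := X * (Ah * Bh - M)ᵀ with hD
  set Dr := X * (A' * B' - M)ᵀ with hDr
  set E := Y - X * Mᵀ with hE
  have e1 : Y - X * (Ah * Bh)ᵀ = E - D := by
    simp only [hE, hD, Matrix.transpose_sub, Matrix.mul_sub]; abel
  have e2 : Y - X * (A' * B')ᵀ = E - Dr := by
    simp only [hE, hDr, Matrix.transpose_sub, Matrix.mul_sub]; abel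
  have h1 := hfit A' B'
  rw [e1, e2, frobSq_sub E D, frobSq_sub E Dr] at h1
  have e3 : D - Dr = X * (Ah * Bh - A' * B')ᵀ := by
    simp only [hD, hDr, Matrix.transpose_sub, Matrix.mul_sub]; abel
  have hrank : (Ah * Bh - A' * B').rank ≤ 2 * r := by
    have : Ah * Bh - A' * B' = Matrix.fromCols Ah (-A') * Matrix.fromRows Bh B' := by
      rw [Matrix.fromCols_mul_fromRows, Matrix.neg_mul, sub_eq_add_neg]
    rw [this]
    refine (Matrix.rank_mul_le_left _ _).trans ((Matrix.rank_le_card_width _).trans ?_)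
    simp [two_mul]
  have h2 := frobInner_le_singVal_mul X E _ hrank
  rw [← e3] at h2
  have h3 : ∑ i, ∑ j, E i j * (D - Dr) i j =
      (∑ i, ∑ j, E i j * D i j) - ∑ i, ∑ j, E i j * Dr i j := by
    simp only [Matrix.sub_apply, mul_sub, Finset.sum_sub_distrib]
  have h4 : frobSq (D - Dr) ≤ 2 * frobSq D + 2 * frobSq Dr := by
    simp only [frobSq, Matrix.sub_apply, Finset.mul_sum, ← Finset.sum_add_distrib]
    refine Finset.sum_le_sum fun i _ => Finset.sum_le_sum fun j _ => ?_
    nlinarith [sq_nonneg (D i j + Dr i j)]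
  have h5 : frobSq Dr ≤ ∑ j ∈ Finset.Ico r k, singVal (M * Xᵀ) j ^ 2 := by
    refine le_trans (le_of_eq ?_) hW
    rw [frobSq]
    refine Finset.sum_congr rfl fun i _ => ?_
    have : Matrix.toEuclideanLin (M * Xᵀ) (EuclideanSpace.basisFun (Fin n) ℝ i) -
        U.starProjection (Matrix.toEuclideanLin (M * Xᵀ) (EuclideanSpace.basisFun (Fin n) ℝ i)) =
        WithLp.toLp 2 (-(Dr i)) := by
      rw [toEuclideanLin_mul_apply, ← hAB, ← LinearMap.sub_apply, ← map_sub,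
        ← toEuclideanLin_mul_apply]
      ext j
      have hneg : Dr = (-((M - A' * B') * Xᵀ))ᵀ := by
        rw [hDr, ← Matrix.neg_mul, neg_sub, Matrix.transpose_mul, Matrix.transpose_transpose]
      rw [hneg]
      generalize (M - A' * B') * Xᵀ = G
      simp [Matrix.toEuclideanLin]
    rw [this, EuclideanSpace.norm_sq_eq]
    simp
  set d := singVal (columnProj X * E) 0
  -- This is `2ab ≤ 4a² + b²/4`. With `h4`, the last term is at most half of `frobSq D` plus half of
  -- `frobSq Dr`; absorbing the former and doubling gives the constants `3` and `16`.
  have h6 : 2 * (d * (√(2 * r : ℕ) * √(frobSq (D - Dr)))) ≤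
      4 * (d ^ 2 * (2 * r)) + frobSq (D - Dr) / 4 := by
    have s1 := Real.sq_sqrt (frobSq_nonneg (D - Dr))
    have s2 := Real.sq_sqrt (Nat.cast_nonneg (α := ℝ) (2 * r))
    push_cast at s2 ⊢
    nlinarith [sq_nonneg (2 * (d * √(2 * r)) - √(frobSq (D - Dr)) / 2)]
  nlinarith

end RRPolicy

/-! ### Bernstein's inequality. -/

namespace RRPolicy

theorem two_mul_three_pow_le_factorial (k : ℕ) : 2 * 3 ^ k ≤ (k + 2).factorial := by
  induction k with
  | zero => simp
  | succ k ih =>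
    rw [Nat.factorial_succ, pow_succ]
    nlinarith

/-- Since `(k+2)! ≥ 2 · 3^k`, the Taylor tail from the quadratic term on is dominated by a geometric
series of ratio `a / 3`. -/
theorem exp_le_one_add_add_sq {x a : ℝ} (hx : |x| ≤ a) (ha : a < 3) :
    Real.exp x ≤ 1 + x + x ^ 2 / (2 * (1 - a / 3)) := by
  have h1 : HasSum (fun k : ℕ => x ^ k / k.factorial) (Real.exp x) := by
    rw [Real.exp_eq_exp_ℝ]
    exact NormedSpace.expSeries_div_hasSum_exp x
  have h2 := (hasSum_nat_add_iff' 2).2 h1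
  have ha0 : 0 ≤ a := (abs_nonneg x).trans hx
  have h3 : HasSum (fun k : ℕ => x ^ 2 / 2 * (a / 3) ^ k) (x ^ 2 / 2 * (1 - a / 3)⁻¹) :=
    (hasSum_geometric_of_lt_one (by positivity) (by linarith)).mul_left _
  have h4 := hasSum_le (fun k => ?_) h2 h3
  · have : x ^ 2 / (2 * (1 - a / 3)) = x ^ 2 / 2 * (1 - a / 3)⁻¹ := by
      rw [div_mul_eq_div_div, div_eq_mul_inv (x ^ 2 / 2)]
    rw [this]
    simp [Finset.sum_range_succ] at h4
    linarith
  · have hk : (2 * 3 ^ k : ℝ) ≤ ((k + 2).factorial : ℝ) := by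
      exact_mod_cast two_mul_three_pow_le_factorial k
    have hxk : x ^ (k + 2) ≤ x ^ 2 * a ^ k := by
      refine (le_abs_self _).trans ?_
      rw [abs_pow, pow_add, mul_comm, ← sq_abs x]
      gcongr
    calc x ^ (k + 2) / ((k + 2).factorial : ℝ) ≤ x ^ 2 * a ^ k / ((k + 2).factorial : ℝ) := by
          gcongr
      _ ≤ x ^ 2 * a ^ k / (2 * 3 ^ k) := by gcongr
      _ = x ^ 2 / 2 * (a / 3) ^ k := by rw [div_pow]; field_simp

section Bernstein

variable {Ω : Type*} [MeasurableSpace Ω] {μ : Measure Ω} [IsProbabilityMeasure μ]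

/-- Integrate the quadratic bound for `exp`; the linear term vanishes by centring, and `1 + u ≤ exp
u`. -/
theorem mgf_le_exp_of_abs_le {Z : Ω → ℝ} {M v l : ℝ} (hZ : Measurable Z)
    (hM : ∀ᵐ ω ∂μ, |Z ω| ≤ M) (h0 : ∫ ω, Z ω ∂μ = 0) (hv : ∫ ω, Z ω ^ 2 ∂μ ≤ v) (hl : 0 ≤ l)
    (hlM : l * M < 3) : mgf Z μ l ≤ Real.exp (l ^ 2 * v / (2 * (1 - l * M / 3))) := by
  have hi : Integrable Z μ := Integrable.of_bound hZ.aestronglyMeasurable M (by simpa using hM)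
  have hi2 : Integrable (fun ω => Z ω ^ 2) μ := by
    refine Integrable.of_bound (by fun_prop) (M ^ 2) ?_
    filter_upwards [hM] with ω h
    rw [Real.norm_eq_abs, abs_pow]
    gcongr
  have hden : 0 < 2 * (1 - l * M / 3) := by linarith
  have h1 : mgf Z μ l ≤ ∫ ω, (1 + l * Z ω + l ^ 2 / (2 * (1 - l * M / 3)) * Z ω ^ 2) ∂μ := by
    refine integral_mono_of_nonneg (ae_of_all _ fun ω => (Real.exp_pos _).le) ?_ ?_
    · exact ((integrable_const _).add (hi.const_mul _)).add (hi2.const_mul _)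
    · filter_upwards [hM] with ω h
      have : |l * Z ω| ≤ l * M := by
        rw [abs_mul, abs_of_nonneg hl]
        gcongr
      refine (exp_le_one_add_add_sq this hlM).trans (le_of_eq ?_)
      ring
  have hi1 : Integrable (fun ω => 1 + l * Z ω) μ := (integrable_const _).add (hi.const_mul _)
  rw [integral_add hi1 (hi2.const_mul _),
    integral_add (integrable_const _) (hi.const_mul _), integral_const_mul, integral_const_mul,
    h0] at h1
  simp only [integral_const, probReal_univ, smul_eq_mul, mul_one, mul_zero, add_zero] at h1
  refine h1.trans ?_
  have h2 : l ^ 2 / (2 * (1 - l * M / 3)) * ∫ ω, Z ω ^ 2 ∂μ ≤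
      l ^ 2 / (2 * (1 - l * M / 3)) * v := by gcongr
  have h3 := Real.add_one_le_exp (l ^ 2 * v / (2 * (1 - l * M / 3)))
  have h4 : l ^ 2 * v / (2 * (1 - l * M / 3)) = l ^ 2 / (2 * (1 - l * M / 3)) * v := by ring
  rw [h4] at h3 ⊢
  linarith

/-- One-sided Bernstein inequality for centred bounded i.i.d. variables. -/
theorem measure_bernstein_upper_le {Z : ℕ → Ω → ℝ} {M v x : ℝ} (hZ : ∀ i, Measurable (Z i))
    (hind : iIndepFun Z μ) (hid : ∀ i, IdentDistrib (Z i) (Z 0) μ μ)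
    (hM : ∀ᵐ ω ∂μ, |Z 0 ω| ≤ M) (h0 : ∫ ω, Z 0 ω ∂μ = 0) (hv : ∫ ω, Z 0 ω ^ 2 ∂μ ≤ v)
    (hx : 0 ≤ x) {n : ℕ} (hn : 1 ≤ n) :
    μ {ω | √(2 * x * (v / n)) + M / (3 * n) * x < (∑ i ∈ Finset.range n, Z i ω) / n} ≤
      ENNReal.ofReal (Real.exp (-x)) := by
  have hM0 : 0 ≤ M := by
    obtain ⟨ω, hω⟩ := hM.exists
    exact (abs_nonneg _).trans hω
  have hv0 : 0 ≤ v := (integral_nonneg fun ω => sq_nonneg (Z 0 ω)).trans hv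
  have hn0 : (0 : ℝ) < n := by exact_mod_cast hn
  -- The optimal Chernoff parameter divides by `v`. If `v = 0` the variables vanish almost surely,
  -- and the event, being a strict inequality, is null.
  rcases hv0.eq_or_lt with hv0 | hvpos
  · have hi2 : Integrable (fun ω => Z 0 ω ^ 2) μ := by
      refine Integrable.of_bound (by have := hZ 0; fun_prop) (M ^ 2) ?_
      filter_upwards [hM] with ω h
      rw [Real.norm_eq_abs, abs_pow]
      gcongr
    have hz0 : ∀ᵐ ω ∂μ, Z 0 ω = 0 := by
      have h2 : ∫ ω, Z 0 ω ^ 2 ∂μ = 0 :=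
        le_antisymm (hv.trans hv0.symm.le) (integral_nonneg fun ω => sq_nonneg (Z 0 ω))
      have h3 := (integral_eq_zero_iff_of_nonneg (fun ω => sq_nonneg (Z 0 ω)) hi2).1 h2
      filter_upwards [h3] with ω h
      simpa using h
    have hzi : ∀ᵐ ω ∂μ, ∀ i, Z i ω = 0 := by
      refine ae_all_iff.2 fun i => ?_
      exact (hid i).symm.ae_mem_snd (measurableSet_singleton (0 : ℝ)) hz0
    refine le_of_eq_of_le ?_ zero_le
    refine measure_eq_zero_iff_ae_notMem.2 ?_
    filter_upwards [hzi] with ω h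
    simp only [h, not_lt, Finset.sum_const_zero, zero_div]
    positivity
  · set s := √(2 * x / (n * v)) with hs
    have hs0 : 0 ≤ s := Real.sqrt_nonneg _
    have hs2 : s ^ 2 = 2 * x / (n * v) := Real.sq_sqrt (by positivity)
    have hx2 : x = n * v * s ^ 2 / 2 := by rw [hs2]; field_simp
    have hsq : √(2 * x * (v / n)) = v * s := by
      rw [hx2, show 2 * (n * v * s ^ 2 / 2) * (v / n) = (v * s) ^ 2 by field_simp]
      exact Real.sqrt_sq (by positivity)
    set c := M / 3 with hc
    have hc0 : 0 ≤ c := by positivity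
    -- With `x = n v s² / 2`, this parameter gives `1 - lM/3 = 1/(1 + cs)`, and the Chernoff
    -- exponent becomes exactly `-x`.
    set l := s / (1 + c * s) with hl
    have hcs : 0 < 1 + c * s := by positivity
    have hl0 : 0 ≤ l := by positivity
    have h1l : 1 - l * M / 3 = 1 / (1 + c * s) := by
      rw [hl, show M = 3 * c by rw [hc]; ring]
      field_simp
      ring
    have hlM : l * M < 3 := by
      have : 0 < 1 - l * M / 3 := by rw [h1l]; positivity
      linarith
    have hmi : ∀ i, mgf (Z i) μ l ≤ Real.exp (l ^ 2 * v / (2 * (1 - l * M / 3))) := by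
      intro i
      rw [mgf_congr_of_identDistrib _ _ (hid i) l]
      exact mgf_le_exp_of_abs_le (hZ 0) hM h0 hv hl0 hlM
    have hmi' : ∀ᵐ ω ∂μ, ∀ i, |Z i ω| ≤ M := by
      refine ae_all_iff.2 fun i => ?_
      have hms : MeasurableSet {y : ℝ | |y| ≤ M} := measurableSet_le (by fun_prop) (by fun_prop)
      exact (hid i).symm.ae_mem_snd hms hM
    have hint : Integrable (fun ω => Real.exp (l * (∑ i ∈ Finset.range n, Z i) ω)) μ := by
      refine Integrable.of_bound ?_ (Real.exp (l * (n * M))) ?_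
      · refine Measurable.aestronglyMeasurable ?_
        have : Measurable (∑ i ∈ Finset.range n, Z i) := by fun_prop
        fun_prop
      · filter_upwards [hmi'] with ω h
        rw [Real.norm_eq_abs, abs_of_pos (Real.exp_pos _), Finset.sum_apply]
        gcongr
        refine (Finset.sum_le_sum fun i _ => (le_abs_self _).trans (h i)).trans ?_
        simp
    have hch := measure_ge_le_exp_mul_mgf (μ := μ) (X := ∑ i ∈ Finset.range n, Z i)
      (n * (v * s + M / (3 * n) * x)) hl0 hint
    rw [hind.mgf_sum hZ] at hch
    have hprod : ∏ i ∈ Finset.range n, mgf (Z i) μ l ≤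
        Real.exp (n * (l ^ 2 * v / (2 * (1 - l * M / 3)))) := by
      rw [Real.exp_nat_mul]
      refine (Finset.prod_le_prod (fun i _ => mgf_nonneg) fun i _ => hmi i).trans ?_
      simp
    have hfin : μ.real {ω | n * (v * s + M / (3 * n) * x) ≤ (∑ i ∈ Finset.range n, Z i) ω} ≤
        Real.exp (-x) := by
      refine hch.trans ((mul_le_mul_of_nonneg_left hprod (Real.exp_pos _).le).trans ?_)
      rw [← Real.exp_add]
      refine Real.exp_le_exp.2 (le_of_eq ?_)
      rw [h1l, hx2, show M = 3 * c by rw [hc]; ring, hl]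
      field_simp
      ring
    have hsub : {ω | √(2 * x * (v / n)) + M / (3 * n) * x < (∑ i ∈ Finset.range n, Z i ω) / n} ⊆
        {ω | n * (v * s + M / (3 * n) * x) ≤ (∑ i ∈ Finset.range n, Z i) ω} := by
      intro ω h
      simp only [Set.mem_ofPred_eq, Finset.sum_apply] at h ⊢
      rw [hsq, lt_div_iff₀ hn0] at h
      linarith
    refine (measure_mono hsub).trans ?_
    rw [← ofReal_measureReal]
    exact ENNReal.ofReal_le_ofReal hfin

/-- Two-sided Bernstein inequality, in the form used for a union bound over `N` policies. -/
theorem measure_bernsteinTerm_lt_le {W : ℕ → Ω → ℝ} {L v δ : ℝ} (hW : ∀ i, Measurable (W i))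
    (hind : iIndepFun W μ) (hid : ∀ i, IdentDistrib (W i) (W 0) μ μ)
    (hL : ∀ᵐ ω ∂μ, |W 0 ω| ≤ L) (hv : Var[W 0; μ] ≤ v) {N n : ℕ} (hN : 1 ≤ N) (hn : 1 ≤ n)
    (hδ : 0 < δ) (hδ1 : δ < 1) :
    μ {ω | bernsteinTerm N n δ v L <
        |(∑ i ∈ Finset.range n, W i ω) / n - ∫ ω, W 0 ω ∂μ|} ≤ ENNReal.ofReal (δ / N) := by
  have hN' : (1 : ℝ) ≤ N := by exact_mod_cast hN
  set m := ∫ ω, W 0 ω ∂μ with hm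
  set x := Real.log (2 * N / δ) with hx
  have hx0 : 0 ≤ x := Real.log_nonneg (by rw [le_div_iff₀ hδ]; linarith)
  -- Each of the two tails receives half of `δ / N`.
  have hexp : Real.exp (-x) = δ / N / 2 := by
    rw [Real.exp_neg, Real.exp_log (by positivity)]
    field_simp
  have hi : Integrable (W 0) μ :=
    Integrable.of_bound (hW 0).aestronglyMeasurable L (by simpa using hL)
  have hmL : |m| ≤ L := by
    have := norm_integral_le_of_norm_le_const (μ := μ) (f := W 0) (C := L) (by simpa using hL)
    simpa using this
  have hvar : ∫ ω, (W 0 ω - m) ^ 2 ∂μ ≤ v := by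
    rwa [variance_eq_integral (hW 0).aemeasurable] at hv
  have hmean : ∫ ω, (W 0 ω - m) ∂μ = 0 := by
    rw [integral_sub hi (integrable_const _)]
    simp [← hm]
  -- Centring doubles the bound, whence the `2L` in the linear Bernstein term.
  have hbd : ∀ᵐ ω ∂μ, |W 0 ω - m| ≤ 2 * L := by
    filter_upwards [hL] with ω h
    refine (abs_sub _ _).trans ?_
    linarith
  have hn0 : (0 : ℝ) < n := by exact_mod_cast hn
  have up := measure_bernstein_upper_le (Z := fun i ω => W i ω - m) (fun i => by
    have := hW i; fun_prop) (hind.comp (fun _ y => y - m) fun _ => by fun_prop)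
    (fun i => (hid i).comp (u := fun y => y - m) (by fun_prop)) hbd hmean hvar hx0 hn
  have lo := measure_bernstein_upper_le (Z := fun i ω => m - W i ω) (M := 2 * L) (v := v)
    (fun i => by have := hW i; fun_prop) (hind.comp (fun _ y => m - y) fun _ => by fun_prop)
    (fun i => (hid i).comp (u := fun y => m - y) (by fun_prop))
    (by simpa only [abs_sub_comm m] using hbd)
    (by rw [← neg_zero, ← hmean, ← integral_neg]; simp)
    (by simpa only [sub_sq_comm m] using hvar) hx0 hn
  have hsum : ∀ ω, (∑ i ∈ Finset.range n, (W i ω - m)) / n =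
      (∑ i ∈ Finset.range n, W i ω) / n - m := by
    intro ω
    rw [Finset.sum_sub_distrib]
    simp
    field_simp
  have hsum' : ∀ ω, (∑ i ∈ Finset.range n, (m - W i ω)) / n =
      m - (∑ i ∈ Finset.range n, W i ω) / n := by
    intro ω
    rw [Finset.sum_sub_distrib]
    simp
    field_simp
  simp only [hsum, hsum'] at up lo
  have hsub : {ω | bernsteinTerm N n δ v L < |(∑ i ∈ Finset.range n, W i ω) / n - m|} ⊆
      {ω | √(2 * x * (v / n)) + 2 * L / (3 * n) * x < (∑ i ∈ Finset.range n, W i ω) / n - m} ∪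
      {ω | √(2 * x * (v / n)) + 2 * L / (3 * n) * x < m - (∑ i ∈ Finset.range n, W i ω) / n} := by
    intro ω h
    simp only [Set.mem_ofPred_eq, bernsteinTerm, lt_abs, neg_sub] at h
    exact h
  refine (measure_mono hsub).trans ((measure_union_le _ _).trans ((add_le_add up lo).trans ?_))
  rw [← ENNReal.ofReal_add (Real.exp_pos _).le (Real.exp_pos _).le, hexp]
  exact ENNReal.ofReal_le_ofReal (by linarith)

end Bernstein

end RRPolicy

/-! ### The oracle score: conditional expectation and unbiasedness. -/

namespace RRPolicy

theorem integral_mul_eq_of_condExp_ae_eq {Ω : Type*} {m m₀ : MeasurableSpace Ω} {μ : Measure Ω}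
    [IsFiniteMeasure μ] (hm : m ≤ m₀) {f g c : Ω → ℝ} (hg : StronglyMeasurable[m] g)
    (hf : Integrable f μ) (hfg : Integrable (fun ω => f ω * g ω) μ) (hc : c =ᵐ[μ] μ[f | m]) :
    ∫ ω, f ω * g ω ∂μ = ∫ ω, c ω * g ω ∂μ := by
  rw [← integral_condExp (m := m) (f := fun ω => f ω * g ω) hm]
  refine integral_congr_ae ?_
  filter_upwards [condExp_mul_of_stronglyMeasurable_right hg hfg hf, hc] with ω h1 h2
  rw [h2]
  exact h1

/-- Law of total variance: the dropped term is the mean of the conditional variance. -/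
theorem variance_condExp_le {Ω : Type*} {m m₀ : MeasurableSpace Ω} {μ : Measure Ω}
    [IsProbabilityMeasure μ] (hm : m ≤ m₀) {f : Ω → ℝ} (hf : MemLp f 2 μ) :
    Var[μ[f | m]; μ] ≤ Var[f; μ] := by
  rw [← integral_condVar_add_variance_condExp hm hf]
  have : 0 ≤ μ[Var[f; μ | m]] := by
    rw [condVar, integral_condExp hm]
    exact integral_nonneg fun ω => sq_nonneg _
  linarith

theorem ind_nonneg (T t : Fin 2) : 0 ≤ ind T t := by
  unfold ind; split_ifs <;> norm_num

theorem ind_le_one (T t : Fin 2) : ind T t ≤ 1 := by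
  unfold ind; split_ifs <;> norm_num

theorem ind_mul_self (T t : Fin 2) : ind T t * ind T t = ind T t := by
  unfold ind; split_ifs <;> norm_num

theorem abs_ind_le_one (T t : Fin 2) : |ind T t| ≤ 1 := by
  rw [abs_of_nonneg (ind_nonneg T t)]
  exact ind_le_one T t

theorem measurable_ind (t : Fin 2) : Measurable fun T => ind T t := Measurable.of_discrete

theorem Policy.prob_le_one {p : ℕ} (π : Policy p) (t : Fin 2) (x : Fin p → ℝ) :
    π.prob t x ≤ 1 := by
  rw [← π.sum_eq_one x]
  exact Finset.single_le_sum (fun t _ => π.nonneg t x) (Finset.mem_univ t)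

theorem Policy.abs_prob_le_one {p : ℕ} (π : Policy p) (t : Fin 2) (x : Fin p → ℝ) :
    |π.prob t x| ≤ 1 := by
  rw [abs_of_nonneg (π.nonneg t x)]
  exact π.prob_le_one t x

theorem measurable_mulVec_apply {k p : ℕ} (M : Matrix (Fin k) (Fin p) ℝ) (j : Fin k) :
    Measurable fun x : Fin p → ℝ => (M *ᵥ x) j := by
  simp only [Matrix.mulVec, dotProduct]
  fun_prop

namespace IsModel

variable {Ω : Type u} [MeasurableSpace Ω] {μ : Measure Ω} [IsProbabilityMeasure μ] {p k s : ℕ}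
  {X : ℕ → Ω → Fin p → ℝ} {T : ℕ → Ω → Fin 2} {Y : Fin 2 → ℕ → Ω → Fin k → ℝ}
  {e : Fin 2 → (Fin p → ℝ) → ℝ} {A : Fin 2 → Matrix (Fin k) (Fin s) ℝ}
  {B : Fin 2 → Matrix (Fin s) (Fin p) ℝ} {η L : ℝ}

theorem integrable_outcome (h : IsModel μ X T Y e A B η L) (t : Fin 2) (j : Fin k) :
    Integrable (fun ω => Y t 0 ω j) μ := by
  refine Integrable.of_bound ?_ L ?_
  · have := h.measurable_Y t 0
    exact Measurable.aestronglyMeasurable (by fun_prop)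
  · filter_upwards [h.bounded t] with ω hω
    exact hω j

theorem condExp_outcome (h : IsModel μ X T Y e A B η L) (t : Fin 2) (j : Fin k) :
    (fun ω => ((A t * B t) *ᵥ X 0 ω) j) =ᵐ[μ]
      μ[fun ω => Y t 0 ω j | MeasurableSpace.comap (X 0) inferInstance] := by
  have hY : Integrable (Y t 0) μ := Integrable.of_eval fun j => h.integrable_outcome t j
  have h1 := ContinuousLinearMap.comp_condExp_comm (m := MeasurableSpace.comap (X 0) inferInstance)
    hY (ContinuousLinearMap.proj (R := ℝ) (φ := fun _ : Fin k => ℝ) j)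
  filter_upwards [h1, h.outcome_model t] with ω h2 h3
  rw [← h3]
  exact h2

/-- Conditional expectations inherit almost sure bounds. Thus `A_t B_t X` is bounded although `X`
need not be, which keeps products with integrable functions integrable. -/
theorem abs_mean_le (h : IsModel μ X T Y e A B η L) (t : Fin 2) :
    ∀ᵐ ω ∂μ, ∀ j, |((A t * B t) *ᵥ X 0 ω) j| ≤ L := by
  refine ae_all_iff.2 fun j => ?_
  have := ae_bdd_abs_condExp_of_ae_bdd_abs (R := L)
    (m := MeasurableSpace.comap (X 0) inferInstance) ((h.bounded t).mono fun _ hω => hω j)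
  filter_upwards [this, h.condExp_outcome t j] with ω h1 h2
  rw [h2]
  exact h1

theorem abs_noise_le (h : IsModel μ X T Y e A B η L) (t : Fin 2) :
    ∀ᵐ ω ∂μ, ∀ j, |Y t 0 ω j - ((A t * B t) *ᵥ X 0 ω) j| ≤ 2 * L := by
  filter_upwards [h.bounded t, h.abs_mean_le t] with ω h1 h2 j
  refine (abs_sub _ _).trans ?_
  linarith [h1 j, h2 j]

omit [IsProbabilityMeasure μ] in
theorem measurable_noise (h : IsModel μ X T Y e A B η L) (t : Fin 2) (j : Fin k) :
    Measurable fun ω => Y t 0 ω j - ((A t * B t) *ᵥ X 0 ω) j := by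
  have h1 := h.measurable_Y t 0
  have h2 := (measurable_mulVec_apply (A t * B t) j).comp (h.measurable_X 0)
  exact Measurable.sub (by fun_prop) h2

theorem integrable_mul_noise (h : IsModel μ X T Y e A B η L) (t : Fin 2) (j : Fin k)
    {g : Ω → ℝ} (hg : Integrable g μ) :
    Integrable (fun ω => g ω * (Y t 0 ω j - ((A t * B t) *ᵥ X 0 ω) j)) μ :=
  hg.mul_bdd (h.measurable_noise t j).aestronglyMeasurable
    ((h.abs_noise_le t).mono fun _ hω => hω j)

theorem integral_mul_outcome (h : IsModel μ X T Y e A B η L) (t : Fin 2) (j : Fin k)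
    {f : (Fin p → ℝ) → ℝ} (hf : Measurable f) (hfi : Integrable (fun ω => f (X 0 ω)) μ) :
    ∫ ω, Y t 0 ω j * f (X 0 ω) ∂μ = ∫ ω, ((A t * B t) *ᵥ X 0 ω) j * f (X 0 ω) ∂μ := by
  refine integral_mul_eq_of_condExp_ae_eq (h.measurable_X 0).comap_le ?_ (h.integrable_outcome t j)
    ?_ (h.condExp_outcome t j)
  · exact (hf.comp (comap_measurable (X 0))).stronglyMeasurable
  · exact hfi.bdd_mul (h.integrable_outcome t j).aestronglyMeasurable
      ((h.bounded t).mono fun _ hω => hω j)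

theorem integrable_mean_mul (h : IsModel μ X T Y e A B η L) (t : Fin 2) (j : Fin k)
    {g : Ω → ℝ} (hg : Integrable g μ) :
    Integrable (fun ω => ((A t * B t) *ᵥ X 0 ω) j * g ω) μ :=
  hg.bdd_mul ((measurable_mulVec_apply (A t * B t) j).comp
    (h.measurable_X 0)).aestronglyMeasurable ((h.abs_mean_le t).mono fun _ hω => hω j)

theorem integrable_outcome_mul (h : IsModel μ X T Y e A B η L) (t : Fin 2) (j : Fin k)
    {g : Ω → ℝ} (hg : Integrable g μ) : Integrable (fun ω => Y t 0 ω j * g ω) μ :=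
  hg.bdd_mul (h.integrable_outcome t j).aestronglyMeasurable
      ((h.bounded t).mono fun _ hω => hω j)

theorem integral_noise_mul (h : IsModel μ X T Y e A B η L) (t : Fin 2) (j : Fin k)
    {f : (Fin p → ℝ) → ℝ} (hf : Measurable f) (hfi : Integrable (fun ω => f (X 0 ω)) μ) :
    ∫ ω, f (X 0 ω) * (Y t 0 ω j - ((A t * B t) *ᵥ X 0 ω) j) ∂μ = 0 := by
  have heq : ∀ ω, f (X 0 ω) * (Y t 0 ω j - ((A t * B t) *ᵥ X 0 ω) j) =
      Y t 0 ω j * f (X 0 ω) - ((A t * B t) *ᵥ X 0 ω) j * f (X 0 ω) := fun ω => by ring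
  simp only [heq]
  rw [integral_sub (h.integrable_outcome_mul t j hfi) (h.integrable_mean_mul t j hfi),
    h.integral_mul_outcome t j hf hfi, sub_self]

theorem integrable_ind (h : IsModel μ X T Y e A B η L) (t : Fin 2) :
    Integrable (fun ω => ind (T 0 ω) t) μ :=
  Integrable.of_bound ((measurable_ind t).comp (h.measurable_T 0)).aestronglyMeasurable 1
    (ae_of_all _ fun _ => abs_ind_le_one _ _)

theorem integrable_ind_mul (h : IsModel μ X T Y e A B η L) (t : Fin 2) {g : Ω → ℝ}
    (hg : Integrable g μ) : Integrable (fun ω => ind (T 0 ω) t * g ω) μ :=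
  hg.bdd_mul (h.integrable_ind t).aestronglyMeasurable (ae_of_all _ fun _ => abs_ind_le_one _ _)

theorem integral_ind_mul (h : IsModel μ X T Y e A B η L) (t : Fin 2)
    {f : (Fin p → ℝ) → ℝ} (hf : Measurable f) (hfi : Integrable (fun ω => f (X 0 ω)) μ) :
    ∫ ω, ind (T 0 ω) t * f (X 0 ω) ∂μ = ∫ ω, e t (X 0 ω) * f (X 0 ω) ∂μ :=
  integral_mul_eq_of_condExp_ae_eq (h.measurable_X 0).comap_le
    (hf.comp (comap_measurable (X 0))).stronglyMeasurable (h.integrable_ind t)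
    (h.integrable_ind_mul t hfi) (h.propensity t)

omit [IsProbabilityMeasure μ] in
theorem integrable_propensity_mul (h : IsModel μ X T Y e A B η L) (hη : 0 < η) (t : Fin 2)
    {g : Ω → ℝ} (hg : Integrable g μ) : Integrable (fun ω => e t (X 0 ω) * g ω) μ := by
  refine hg.bdd_mul (c := 1) ((h.measurable_e t).comp (h.measurable_X 0)).aestronglyMeasurable
    (ae_of_all _ fun ω => ?_)
  have := h.overlap t (X 0 ω)
  rw [Real.norm_eq_abs, abs_of_pos (by linarith)]
  exact this.2.le

/-- Conditioning on `(X, Y(t))`, ignorability replaces `𝟙[T = t]` by `e_t(X)`; what remains is a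
function of `X` times noise that is centred given `X`. -/
theorem integral_ind_mul_noise (h : IsModel μ X T Y e A B η L) (hη : 0 < η) (t : Fin 2)
    (j : Fin k) {f : (Fin p → ℝ) → ℝ} (hf : Measurable f)
    (hfi : Integrable (fun ω => f (X 0 ω)) μ) :
    ∫ ω, ind (T 0 ω) t * (f (X 0 ω) * (Y t 0 ω j - ((A t * B t) *ᵥ X 0 ω) j)) ∂μ = 0 := by
  have hle : MeasurableSpace.comap (X 0) inferInstance ⊔
      MeasurableSpace.comap (Y t 0) inferInstance ≤ (inferInstance : MeasurableSpace Ω) :=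
    sup_le (h.measurable_X 0).comap_le (h.measurable_Y t 0).comap_le
  have hX : Measurable[MeasurableSpace.comap (X 0) inferInstance ⊔
      MeasurableSpace.comap (Y t 0) inferInstance] (X 0) :=
    (comap_measurable (X 0)).mono le_sup_left le_rfl
  have hY : Measurable[MeasurableSpace.comap (X 0) inferInstance ⊔
      MeasurableSpace.comap (Y t 0) inferInstance] (Y t 0) :=
    (comap_measurable (Y t 0)).mono le_sup_right le_rfl
  rw [integral_mul_eq_of_condExp_ae_eq hle
    (c := fun ω => e t (X 0 ω)) ?_ (h.integrable_ind t)
    (h.integrable_ind_mul t (h.integrable_mul_noise t j hfi))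
    ((h.propensity t).trans (h.ignorability t).symm)]
  · simp only [← mul_assoc]
    exact h.integral_noise_mul t j (f := fun x => e t x * f x) ((h.measurable_e t).mul hf)
      (h.integrable_propensity_mul hη t hfi)
  · refine Measurable.stronglyMeasurable ?_
    exact (hf.comp hX).mul (((measurable_pi_apply j).comp hY).sub
      ((measurable_mulVec_apply (A t * B t) j).comp hX))

end IsModel

/-- The denoised score ignores the outcome, so that slot is filled with `0` to exhibit it as a
function of `(x, t)`. -/
theorem measurable_phi_denoisedScore {p k q r : ℕ} {ρ : Fin k → ℝ} {e : Fin 2 → (Fin p → ℝ) → ℝ}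
    (he : ∀ t, Measurable (e t)) (A : Fin 2 → Matrix (Fin k) (Fin r) ℝ)
    (B : Fin 2 → Matrix (Fin r) (Fin p) ℝ) (G : Fin 2 → Matrix (Fin q) (Fin p) ℝ)
    (D : Fin 2 → Fin q → ℝ) (π : Policy p) :
    Measurable fun z : (Fin p → ℝ) × Fin 2 =>
      phi e G D (denoisedScore ρ A B) π (⟨z.1, z.2, 0⟩ : Obs p k) := by
  have h1 := π.measurable_prob
  have h2 := measurable_ind
  have h3 := fun t => measurable_mulVec_apply (A t * B t)
  have h4 := fun t => measurable_mulVec_apply (G t)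
  simp only [phi, denoisedScore, controlVariate, dotProduct, Pi.smul_apply, smul_eq_mul]
  fun_prop

/-- The control variates cancel, and under the indicator `𝟙[t' = t]` the observed outcome `y t'` may
be written as `y t`; inverse-propensity-weighted residuals remain. -/
theorem phi_observedScore_sub_denoisedScore {p k q r : ℕ} (ρ : Fin k → ℝ)
    (e : Fin 2 → (Fin p → ℝ) → ℝ) (A : Fin 2 → Matrix (Fin k) (Fin r) ℝ)
    (B : Fin 2 → Matrix (Fin r) (Fin p) ℝ) (G : Fin 2 → Matrix (Fin q) (Fin p) ℝ)
    (D : Fin 2 → Fin q → ℝ) (π : Policy p) (x : Fin p → ℝ) (t' : Fin 2)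
    (y : Fin 2 → Fin k → ℝ) :
    phi e G D (observedScore ρ) π ⟨x, t', y t'⟩ -
        phi e G D (denoisedScore ρ A B) π (⟨x, t', 0⟩ : Obs p k) =
      ∑ t, ∑ j, ρ j * (ind t' t * (π.prob t x / e t x * (y t j - ((A t * B t) *ᵥ x) j))) := by
  simp only [phi, ← Finset.sum_sub_distrib]
  refine Finset.sum_congr rfl fun t _ => ?_
  rw [← mul_sub]
  have : ind t' t * (observedScore ρ t (⟨x, t', y t'⟩ : Obs p k)) = ind t' t * (ρ ⬝ᵥ y t) := by
    unfold ind observedScore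
    split_ifs with h
    · rw [h]
    · simp
  have h2 : ∑ j, ρ j * (ind t' t * (π.prob t x / e t x * (y t j - ((A t * B t) *ᵥ x) j))) =
      π.prob t x * ((ind t' t * (ρ ⬝ᵥ y t) - ind t' t * (ρ ⬝ᵥ ((A t * B t) *ᵥ x))) / e t x) := by
    simp only [dotProduct, Finset.mul_sum, ← Finset.sum_sub_distrib, Finset.sum_div]
    exact Finset.sum_congr rfl fun j _ => by ring
  rw [h2]
  simp only [this]
  simp only [controlVariate, denoisedScore]
  ring

namespace IsModel

variable {Ω : Type u} [MeasurableSpace Ω] {μ : Measure Ω} [IsProbabilityMeasure μ] {p k s : ℕ}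
  {X : ℕ → Ω → Fin p → ℝ} {T : ℕ → Ω → Fin 2} {Y : Fin 2 → ℕ → Ω → Fin k → ℝ}
  {e : Fin 2 → (Fin p → ℝ) → ℝ} {A : Fin 2 → Matrix (Fin k) (Fin s) ℝ}
  {B : Fin 2 → Matrix (Fin s) (Fin p) ℝ} {η L : ℝ}

theorem integrable_weight (h : IsModel μ X T Y e A B η L) (hη : 0 < η) (π : Policy p) (t : Fin 2) :
    Integrable (fun ω => π.prob t (X 0 ω) / e t (X 0 ω)) μ := by
  refine Integrable.of_bound ?_ (1 / η) (ae_of_all _ fun ω => ?_)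
  · exact (((π.measurable_prob t).div (h.measurable_e t)).comp
      (h.measurable_X 0)).aestronglyMeasurable
  · have := h.overlap t (X 0 ω)
    rw [Real.norm_eq_abs, abs_div, abs_of_pos (a := e t (X 0 ω)) (by linarith)]
    exact div_le_div₀ zero_le_one (π.abs_prob_le_one _ _) hη this.1

/-- The score with the conditional mean plugged in is the conditional expectation of the observed
score given the covariates and the treatment. -/
theorem condExp_phi (h : IsModel μ X T Y e A B η L) (hη : 0 < η) (ρ : Fin k → ℝ)
    (D : Fin 2 → Fin s → ℝ) (π : Policy p)
    (hbdd : ∀ᵐ ω ∂μ, |phi e B D (observedScore ρ) π (observed X T Y 0 ω)| ≤ L) :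
    MemLp (fun ω => phi e B D (observedScore ρ) π (observed X T Y 0 ω)) 2 μ ∧
    (fun ω => phi e B D (denoisedScore ρ A B) π (⟨X 0 ω, T 0 ω, 0⟩ : Obs p k)) =ᵐ[μ]
      μ[fun ω => phi e B D (observedScore ρ) π (observed X T Y 0 ω) |
        MeasurableSpace.comap (fun ω => (X 0 ω, T 0 ω)) inferInstance] := by
  set ψ := fun ω => phi e B D (denoisedScore ρ A B) π (⟨X 0 ω, T 0 ω, 0⟩ : Obs p k)
  set φ := fun ω => phi e B D (observedScore ρ) π (observed X T Y 0 ω)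
  set ξ := fun ω => ∑ t, ∑ j, ρ j * (ind (T 0 ω) t * (π.prob t (X 0 ω) / e t (X 0 ω) *
    (Y t 0 ω j - ((A t * B t) *ᵥ X 0 ω) j)))
  have hXT : Measurable fun ω => (X 0 ω, T 0 ω) := (h.measurable_X 0).prodMk (h.measurable_T 0)
  have hφ : ∀ ω, φ ω = ψ ω + ξ ω := fun ω => by
    have := phi_observedScore_sub_denoisedScore ρ e A B B D π (X 0 ω) (T 0 ω) fun t => Y t 0 ω
    simp only [ξ, ← this]
    exact (add_sub_cancel _ _).symm
  have hterm : ∀ t j, Integrable (fun ω => ρ j * (ind (T 0 ω) t * (π.prob t (X 0 ω) / e t (X 0 ω) *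
      (Y t 0 ω j - ((A t * B t) *ᵥ X 0 ω) j)))) μ := fun t j =>
    (h.integrable_ind_mul t (h.integrable_mul_noise t j (h.integrable_weight hη π t))).const_mul _
  have hξ : Integrable ξ μ :=
    integrable_finsetSum _ fun t _ => integrable_finsetSum _ fun j _ => hterm t j
  have hψm : Measurable ψ := (measurable_phi_denoisedScore h.measurable_e A B B D π).comp hXT
  have hφm : AEStronglyMeasurable φ μ :=
    (hψm.aestronglyMeasurable.add hξ.aestronglyMeasurable).congr (ae_of_all _ fun ω => (hφ ω).symm)
  have hφi : Integrable φ μ := Integrable.of_bound hφm L hbdd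
  have hψi : Integrable ψ μ := (hφi.sub hξ).congr (ae_of_all _ fun ω => by simp [hφ ω])
  refine ⟨MemLp.of_bound hφm L hbdd, ?_⟩
  refine ae_eq_condExp_of_forall_setIntegral_eq hXT.comap_le hφi
    (fun S _ _ => hψi.integrableOn) ?_ ?_
  · rintro S ⟨S', hS', rfl⟩ -
    simp only [hφ]
    rw [integral_add hψi.integrableOn hξ.integrableOn, eq_comm, add_eq_left]
    rw [integral_finsetSum _ fun t _ => integrable_finsetSum _ fun j _ => (hterm t j).integrableOn]
    refine Finset.sum_eq_zero fun t _ => ?_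
    rw [integral_finsetSum _ fun j _ => (hterm t j).integrableOn]
    refine Finset.sum_eq_zero fun j _ => ?_
    rw [integral_const_mul, ← integral_indicator (hXT hS')]
    -- On `T = t`, membership of `(X, T)` in `S'` depends on `X` alone, through the slice of `S'` at
    -- `t`. The test function is therefore a function of `X`, as orthogonality to the noise
    -- requires.
    have hSt : MeasurableSet {x : Fin p → ℝ | (x, t) ∈ S'} := measurable_prodMk_right hS'
    have h0 := h.integral_ind_mul_noise hη t j
      (f := {x : Fin p → ℝ | (x, t) ∈ S'}.indicator fun x => π.prob t x / e t x)
      (((π.measurable_prob t).div (h.measurable_e t)).indicator hSt)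
      ((h.integrable_weight hη π t).indicator (h.measurable_X 0 hSt))
    rw [mul_eq_zero]
    right
    rw [← h0]
    refine integral_congr_ae (ae_of_all _ fun ω => ?_)
    simp only [Set.indicator, Set.mem_preimage, Set.mem_ofPred_eq, ind]
    by_cases hT : T 0 ω = t
    · subst hT
      by_cases hS : (X 0 ω, T 0 ω) ∈ S' <;> simp [hS]
    · simp [hT]
  · exact ((measurable_phi_denoisedScore h.measurable_e A B B D π).comp
      (comap_measurable _)).aestronglyMeasurable

theorem integrable_covariate (h : IsModel μ X T Y e A B η L) (a : Fin p) :
    Integrable (fun ω => X 0 ω a) μ :=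
  (h.memLp_X.integrable one_le_two).eval a

theorem integrable_mulVec (h : IsModel μ X T Y e A B η L) {q : ℕ} (G : Matrix (Fin q) (Fin p) ℝ)
    (l : Fin q) : Integrable (fun ω => (G *ᵥ X 0 ω) l) μ := by
  simp only [Matrix.mulVec, dotProduct]
  exact integrable_finsetSum _ fun a _ => (h.integrable_covariate a).const_mul _

theorem integral_ind_div_mul (h : IsModel μ X T Y e A B η L) (hη : 0 < η) (t : Fin 2)
    {f : (Fin p → ℝ) → ℝ} (hf : Measurable f) (hfi : Integrable (fun ω => f (X 0 ω)) μ) :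
    Integrable (fun ω => ind (T 0 ω) t / e t (X 0 ω) * f (X 0 ω)) μ ∧
    ∫ ω, ind (T 0 ω) t / e t (X 0 ω) * f (X 0 ω) ∂μ = ∫ ω, f (X 0 ω) ∂μ := by
  have he : ∀ x, e t x ≠ 0 := fun x => by have := h.overlap t x; linarith
  have hi : Integrable (fun ω => (e t (X 0 ω))⁻¹ * f (X 0 ω)) μ := by
    refine hfi.bdd_mul (c := 1 / η) ((h.measurable_e t).inv.comp
      (h.measurable_X 0)).aestronglyMeasurable (ae_of_all _ fun ω => ?_)
    have := h.overlap t (X 0 ω)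
    rw [Real.norm_eq_abs, abs_inv, abs_of_pos (a := e t (X 0 ω)) (by linarith), one_div]
    exact inv_anti₀ hη this.1
  simp only [div_eq_mul_inv, mul_assoc]
  refine ⟨h.integrable_ind_mul t hi, ?_⟩
  rw [h.integral_ind_mul t (f := fun x => (e t x)⁻¹ * f x) ((h.measurable_e t).inv.mul hf) hi]
  refine integral_congr_ae (ae_of_all _ fun ω => ?_)
  exact mul_inv_cancel_left₀ (he _) _

/-- The factor `𝟙[T = t] / e_t(X)` integrates like `1` against functions of `X`, so the control
variates have mean zero for any weights, and the outcome model turns `A_t B_t X` back into `Y(t)`.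
-/
theorem integral_phi_denoisedScore (h : IsModel μ X T Y e A B η L) (hη : 0 < η) (ρ : Fin k → ℝ)
    (D : Fin 2 → Fin s → ℝ) (π : Policy p) :
    ∫ ω, phi e B D (denoisedScore ρ A B) π (⟨X 0 ω, T 0 ω, 0⟩ : Obs p k) ∂μ =
      policyValue μ ρ X Y π := by
  have hπ : ∀ t, Integrable (fun ω => π.prob t (X 0 ω)) μ := fun t =>
    Integrable.of_bound ((π.measurable_prob t).comp (h.measurable_X 0)).aestronglyMeasurable 1
      (ae_of_all _ fun _ => π.abs_prob_le_one _ _)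
  have hf : ∀ t, Measurable fun x => ρ ⬝ᵥ ((A t * B t) *ᵥ x) * π.prob t x := fun t => by
    have h1 := π.measurable_prob t
    have h2 := measurable_mulVec_apply (A t * B t)
    simp only [dotProduct]
    fun_prop
  have hfi : ∀ t, Integrable (fun ω => ρ ⬝ᵥ ((A t * B t) *ᵥ X 0 ω) * π.prob t (X 0 ω)) μ :=
    fun t => by
      simp only [dotProduct, Finset.sum_mul, mul_assoc]
      exact integrable_finsetSum _ fun j _ => (h.integrable_mean_mul t j (hπ t)).const_mul _
  have hg : ∀ t, Measurable fun x => D t ⬝ᵥ (B t *ᵥ x) * π.prob t x := fun t => by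
    have h1 := π.measurable_prob t
    have h2 := measurable_mulVec_apply (B t)
    simp only [dotProduct]
    fun_prop
  have hgi : ∀ t, Integrable (fun ω => D t ⬝ᵥ (B t *ᵥ X 0 ω) * π.prob t (X 0 ω)) μ := fun t => by
    refine Integrable.mul_bdd (c := 1) ?_
      ((π.measurable_prob t).comp (h.measurable_X 0)).aestronglyMeasurable
      (ae_of_all _ fun _ => π.abs_prob_le_one _ _)
    simp only [dotProduct]
    exact integrable_finsetSum _ fun l _ => (h.integrable_mulVec (B t) l).const_mul _
  have h1 : ∀ ω, phi e B D (denoisedScore ρ A B) π (⟨X 0 ω, T 0 ω, 0⟩ : Obs p k) =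
      ∑ t, (ind (T 0 ω) t / e t (X 0 ω) * (ρ ⬝ᵥ ((A t * B t) *ᵥ X 0 ω) * π.prob t (X 0 ω)) +
        (D t ⬝ᵥ (B t *ᵥ X 0 ω) * π.prob t (X 0 ω) -
          ind (T 0 ω) t / e t (X 0 ω) * (D t ⬝ᵥ (B t *ᵥ X 0 ω) * π.prob t (X 0 ω)))) := by
    intro ω
    refine Finset.sum_congr rfl fun t _ => ?_
    simp only [denoisedScore, controlVariate, dotProduct_smul, smul_eq_mul]
    ring
  simp only [h1, policyValue]
  have hYi : ∀ t, Integrable (fun ω => π.prob t (X 0 ω) * (ρ ⬝ᵥ Y t 0 ω)) μ := fun t => by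
    simp only [dotProduct, Finset.mul_sum]
    refine integrable_finsetSum _ fun j _ => ?_
    refine ((h.integrable_outcome_mul t j (hπ t)).const_mul (ρ j)).congr (ae_of_all _ fun ω => ?_)
    simp only
    ring
  have k1 := fun t => h.integral_ind_div_mul hη t (hf t) (hfi t)
  have k2 := fun t => h.integral_ind_div_mul hη t (hg t) (hgi t)
  have k3 : ∀ t, Integrable (fun ω => D t ⬝ᵥ (B t *ᵥ X 0 ω) * π.prob t (X 0 ω) -
      ind (T 0 ω) t / e t (X 0 ω) * (D t ⬝ᵥ (B t *ᵥ X 0 ω) * π.prob t (X 0 ω))) μ :=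
    fun t => (hgi t).sub (k2 t).1
  have k4 : ∀ t, Integrable (fun ω =>
      ind (T 0 ω) t / e t (X 0 ω) * (ρ ⬝ᵥ ((A t * B t) *ᵥ X 0 ω) * π.prob t (X 0 ω)) +
      (D t ⬝ᵥ (B t *ᵥ X 0 ω) * π.prob t (X 0 ω) -
      ind (T 0 ω) t / e t (X 0 ω) * (D t ⬝ᵥ (B t *ᵥ X 0 ω) * π.prob t (X 0 ω)))) μ :=
    fun t => (k1 t).1.add (k3 t)
  rw [integral_finsetSum _ fun t _ => hYi t, integral_finsetSum _ fun t _ => k4 t]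
  refine Finset.sum_congr rfl fun t _ => ?_
  rw [integral_add (k1 t).1 (k3 t), integral_sub (hgi t) (k2 t).1, (k1 t).2,
    (k2 t).2, sub_self, add_zero]
  simp only [dotProduct, Finset.sum_mul, Finset.mul_sum, mul_assoc]
  rw [integral_finsetSum _ fun j _ => (h.integrable_mean_mul t j (hπ t)).const_mul _]
  simp only [mul_left_comm (π.prob t _), mul_comm (π.prob t _)]
  rw [integral_finsetSum _ fun j _ => (h.integrable_outcome_mul t j (hπ t)).const_mul _]
  refine Finset.sum_congr rfl fun j _ => ?_
  rw [integral_const_mul, integral_const_mul,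
    h.integral_mul_outcome t j (π.measurable_prob t) (hπ t)]

end IsModel

end RRPolicy

/-! ### Uniform deviations: cost of denoising and union bound. -/

namespace RRPolicy

theorem frobSq_armDesign_mul {n p k q : ℕ} (S : Fin n → Obs p k) (t : Fin 2)
    (N : Matrix (Fin q) (Fin p) ℝ) :
    frobSq (armDesign S t * Nᵀ) = ∑ i, ind (S i).t t * ∑ j, ((N *ᵥ (S i).x) j) ^ 2 := by
  refine Finset.sum_congr rfl fun i _ => ?_
  rw [Finset.mul_sum]
  refine Finset.sum_congr rfl fun j _ => ?_
  have : (armDesign S t * Nᵀ) i j = ind (S i).t t * (N *ᵥ (S i).x) j := by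
    simp only [Matrix.mul_apply, armDesign, Matrix.of_apply, Matrix.transpose_apply, Matrix.mulVec,
      dotProduct, Finset.mul_sum]
    exact Finset.sum_congr rfl fun a _ => by ring
  rw [this, mul_pow, pow_two (ind _ _), ind_mul_self]

theorem frobSq_armOutcome_sub {n p k : ℕ} (S : Fin n → Obs p k) (t : Fin 2)
    (N : Matrix (Fin k) (Fin p) ℝ) :
    frobSq (armOutcome S t - armDesign S t * Nᵀ) =
      ∑ i, ind (S i).t t * ∑ j, ((S i).y j - (N *ᵥ (S i).x) j) ^ 2 := by
  refine Finset.sum_congr rfl fun i _ => ?_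
  rw [Finset.mul_sum]
  refine Finset.sum_congr rfl fun j _ => ?_
  have : (armOutcome S t - armDesign S t * Nᵀ) i j =
      ind (S i).t t * ((S i).y j - (N *ᵥ (S i).x) j) := by
    simp only [Matrix.sub_apply, Matrix.mul_apply, armDesign, armOutcome, Matrix.of_apply,
      Matrix.transpose_apply, Matrix.mulVec, dotProduct, Finset.mul_sum, mul_sub]
    congr 1
    exact Finset.sum_congr rfl fun a _ => by ring
  rw [this, mul_pow, pow_two (ind _ _), ind_mul_self]

theorem IsRRRFit.frobSq_le {n p k r : ℕ} {S : Fin n → Obs p k}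
    {Ah : Fin 2 → Matrix (Fin k) (Fin r) ℝ} {Bh : Fin 2 → Matrix (Fin r) (Fin p) ℝ}
    (hfit : IsRRRFit S Ah Bh) (M : Matrix (Fin k) (Fin p) ℝ) (t : Fin 2) :
    frobSq (armDesign S t * (Ah t * Bh t - M)ᵀ) ≤
      3 * ∑ j ∈ Finset.Ico r k, singVal (M * (armDesign S t)ᵀ) j ^ 2 +
        16 * r * singVal (columnProj (armDesign S t) * armNoise S M t) 0 ^ 2 := by
  refine frobSq_reducedRank_le _ _ _ _ _ fun A' B' => ?_
  rw [frobSq_armOutcome_sub, frobSq_armOutcome_sub]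
  exact hfit t A' B'

theorem sum_fin_two_mul_ind (f : Fin 2 → ℝ) (T : Fin 2) : ∑ t, ind T t * f t = f T := by
  simp [ind]

/-- Effect of denoising: the estimators with the fitted and with the true outcome model differ by
at most the reduced-rank prediction error. -/
theorem abs_cvEstimator_sub_le {n p k r s : ℕ} {ρ : Fin k → ℝ} {e : Fin 2 → (Fin p → ℝ) → ℝ}
    {η : ℝ} (hη : 0 < η) (he : ∀ t x, η ≤ e t x) {S : Fin n → Obs p k}
    {Ah : Fin 2 → Matrix (Fin k) (Fin r) ℝ} {Bh : Fin 2 → Matrix (Fin r) (Fin p) ℝ}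
    (hfit : IsRRRFit S Ah Bh) (A : Fin 2 → Matrix (Fin k) (Fin s) ℝ)
    (B : Fin 2 → Matrix (Fin s) (Fin p) ℝ) (D : Fin 2 → Fin s → ℝ) (π : Policy p) (hn : 1 ≤ n) :
    |cvEstimator ρ e Ah Bh B D S π - cvEstimator ρ e A B B D S π| ≤
      rrrTerm (3 * ((ρ ⬝ᵥ ρ + 1) / (2 * η ^ 2))) (16 * ((ρ ⬝ᵥ ρ + 1) / (2 * η ^ 2))) r A B S := by
  -- The `2` in the denominator cancels the one in `√(2/n)`; the `+ 1` keeps the constant positive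
  -- when `ρ = 0`.
  set K := (ρ ⬝ᵥ ρ + 1) / (2 * η ^ 2) with hK
  have hρ : 0 ≤ ρ ⬝ᵥ ρ := Finset.sum_nonneg fun j _ => mul_self_nonneg _
  have hK0 : 0 ≤ K := by positivity
  have hn0 : (0 : ℝ) < n := by exact_mod_cast hn
  set q : Fin n → ℝ := fun i => ∑ j, (((Ah (S i).t * Bh (S i).t - A (S i).t * B (S i).t) *ᵥ
    (S i).x) j) ^ 2 with hq
  have hq0 : ∀ i, 0 ≤ q i := fun i => Finset.sum_nonneg fun j _ => sq_nonneg _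
  have hpt : ∀ i, |phi e B D (denoisedScore ρ Ah Bh) π (S i) -
      phi e B D (denoisedScore ρ A B) π (S i)| ≤ √(ρ ⬝ᵥ ρ) / η * √(q i) := by
    intro i
    have h1 : phi e B D (denoisedScore ρ Ah Bh) π (S i) -
        phi e B D (denoisedScore ρ A B) π (S i) =
        π.prob (S i).t (S i).x / e (S i).t (S i).x *
          (ρ ⬝ᵥ ((Ah (S i).t * Bh (S i).t - A (S i).t * B (S i).t) *ᵥ (S i).x)) := by
      rw [← sum_fin_two_mul_ind (fun t => π.prob t (S i).x / e t (S i).x *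
          (ρ ⬝ᵥ ((Ah t * Bh t - A t * B t) *ᵥ (S i).x))), phi, phi, ← Finset.sum_sub_distrib]
      refine Finset.sum_congr rfl fun t _ => ?_
      simp only [denoisedScore, Matrix.sub_mulVec, dotProduct_sub]
      ring
    have h2 : |ρ ⬝ᵥ ((Ah (S i).t * Bh (S i).t - A (S i).t * B (S i).t) *ᵥ (S i).x)| ≤
        √(ρ ⬝ᵥ ρ) * √(q i) := by
      rw [← Real.sqrt_mul hρ]
      refine Real.abs_le_sqrt ?_
      refine (Finset.sum_mul_sq_le_sq_mul_sq _ _ _).trans (le_of_eq ?_)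
      simp [hq, dotProduct, pow_two]
    have hei := he (S i).t (S i).x
    rw [h1, abs_mul, abs_div, abs_of_pos (a := e _ _) (by linarith)]
    calc _ ≤ 1 / η * (√(ρ ⬝ᵥ ρ) * √(q i)) :=
          mul_le_mul (div_le_div₀ zero_le_one (π.abs_prob_le_one _ _) hη hei) h2 (abs_nonneg _)
            (by positivity)
      _ = _ := by ring
  have hQ : ∑ i, q i = ∑ t, frobSq (armDesign S t * (Ah t * Bh t - A t * B t)ᵀ) := by
    simp only [frobSq_armDesign_mul]
    refine Eq.trans ?_ Finset.sum_comm
    exact Finset.sum_congr rfl fun i _ => (sum_fin_two_mul_ind (fun t =>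
      ∑ j, (((Ah t * Bh t - A t * B t) *ᵥ (S i).x) j) ^ 2) _).symm
  have hQle : K * ∑ i, q i ≤ ∑ t, (3 * K * ∑ j ∈ Finset.Ico r k,
      singVal (A t * B t * (armDesign S t)ᵀ) j ^ 2 + 16 * K * r *
        singVal (columnProj (armDesign S t) * armNoise S (A t * B t) t) 0 ^ 2) := by
    rw [hQ, Finset.mul_sum]
    refine Finset.sum_le_sum fun t _ => ?_
    refine (mul_le_mul_of_nonneg_left (hfit.frobSq_le (A t * B t) t) hK0).trans (le_of_eq ?_)
    ring
  have hQ0 : 0 ≤ ∑ i, q i := Finset.sum_nonneg fun i _ => hq0 i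
  have hcs : ∑ i, √(q i) ≤ √n * √(∑ i, q i) := by
    have := Real.sum_mul_le_sqrt_mul_sqrt Finset.univ (fun _ : Fin n => (1 : ℝ)) fun i => √(q i)
    simpa [Real.sq_sqrt (hq0 _)] using this
  have hmain : |cvEstimator ρ e Ah Bh B D S π - cvEstimator ρ e A B B D S π| ≤
      (√(ρ ⬝ᵥ ρ) / η * (√n * √(∑ i, q i))) / n := by
    rw [cvEstimator, cvEstimator, ← sub_div, ← Finset.sum_sub_distrib, abs_div,
      abs_of_pos hn0]
    gcongr
    refine (Finset.abs_sum_le_sum_abs _ _).trans ((Finset.sum_le_sum fun i _ => hpt i).trans ?_)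
    rw [← Finset.mul_sum]
    gcongr
  refine hmain.trans ?_
  refine le_trans (b := √(2 / n) * √(K * ∑ i, q i)) ?_ ?_
  · rw [← Real.sqrt_mul (x := 2 / (n : ℝ)) (by positivity)]
    refine Real.le_sqrt_of_sq_le ?_
    rw [div_pow, mul_pow, div_pow, mul_pow, Real.sq_sqrt hρ, Real.sq_sqrt hn0.le,
      Real.sq_sqrt hQ0, hK]
    rw [show ρ ⬝ᵥ ρ / η ^ 2 * (n * ∑ i, q i) / (n : ℝ) ^ 2 =
      (ρ ⬝ᵥ ρ) * ((∑ i, q i) / (η ^ 2 * n)) by field_simp]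
    rw [show 2 / (n : ℝ) * ((ρ ⬝ᵥ ρ + 1) / (2 * η ^ 2) * ∑ i, q i) =
      (ρ ⬝ᵥ ρ + 1) * ((∑ i, q i) / (η ^ 2 * n)) by field_simp]
    gcongr
    linarith
  · rw [rrrTerm]
    gcongr

/-- Generalization of empirical minimizers from a uniform deviation bound. -/
theorem minimizer_generalization {P : Type*} {Pol : Finset P} {V Vh : P → ℝ} {ε : ℝ}
    (hdev : ∀ π ∈ Pol, |Vh π - V π| ≤ ε) {πstar πhat : P} (hs : πstar ∈ Pol)
    (hopt : ∀ π ∈ Pol, V πstar ≤ V π) (hh : πhat ∈ Pol) (hmin : ∀ π ∈ Pol, Vh πhat ≤ Vh π) :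
    |Vh πhat - V πstar| ≤ ε ∧ V πhat - V πstar ≤ 2 * ε := by
  have h1 := abs_le.1 (hdev _ hs)
  have h2 := abs_le.1 (hdev _ hh)
  have h3 := hmin _ hs
  have h4 := hopt _ hh
  refine ⟨abs_le.2 ⟨?_, ?_⟩, ?_⟩ <;> linarith

namespace IsModel

variable {Ω : Type u} [MeasurableSpace Ω] {μ : Measure Ω} [IsProbabilityMeasure μ] {p k s : ℕ}
  {X : ℕ → Ω → Fin p → ℝ} {T : ℕ → Ω → Fin 2} {Y : Fin 2 → ℕ → Ω → Fin k → ℝ}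
  {e : Fin 2 → (Fin p → ℝ) → ℝ} {A : Fin 2 → Matrix (Fin k) (Fin s) ℝ}
  {B : Fin 2 → Matrix (Fin s) (Fin p) ℝ} {η L : ℝ}

/-- Bernstein is applied to the oracle score, whose bound and variance are controlled by those of
`φ` because it is a conditional expectation of `φ`. -/
theorem measure_bernsteinTerm_lt_cvEstimator_le (h : IsModel μ X T Y e A B η L) (hη : 0 < η)
    (ρ : Fin k → ℝ) (D : Fin 2 → Fin s → ℝ) (π : Policy p)
    (hbdd : ∀ᵐ ω ∂μ, |phi e B D (observedScore ρ) π (observed X T Y 0 ω)| ≤ L) {v δ : ℝ}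
    (hv : Var[fun ω => phi e B D (observedScore ρ) π (observed X T Y 0 ω); μ] ≤ v)
    {N n : ℕ} (hN : 1 ≤ N) (hn : 1 ≤ n) (hδ : 0 < δ) (hδ1 : δ < 1) :
    μ {ω | bernsteinTerm N n δ v L < |cvEstimator ρ e A B B D (sample X T Y n ω) π -
      policyValue μ ρ X Y π|} ≤ ENNReal.ofReal (δ / N) := by
  obtain ⟨hmem, hce⟩ := h.condExp_phi hη ρ D π hbdd
  set g : (Fin p → ℝ) × Fin 2 → ℝ := fun z =>
    phi e B D (denoisedScore ρ A B) π (⟨z.1, z.2, 0⟩ : Obs p k)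
  have hg : Measurable g := measurable_phi_denoisedScore h.measurable_e A B B D π
  have hXT : Measurable fun ω => (X 0 ω, T 0 ω) := (h.measurable_X 0).prodMk (h.measurable_T 0)
  set g' : (Fin p → ℝ) × Fin 2 × (Fin 2 → Fin k → ℝ) → ℝ := fun z => g (z.1, z.2.1)
  have hg' : Measurable g' := hg.comp (by fun_prop)
  have hvar : Var[fun ω => g (X 0 ω, T 0 ω); μ] ≤ v := by
    rw [variance_congr hce]
    exact (variance_condExp_le hXT.comap_le hmem).trans hv
  have hL : ∀ᵐ ω ∂μ, |g (X 0 ω, T 0 ω)| ≤ L := by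
    filter_upwards [ae_bdd_abs_condExp_of_ae_bdd_abs
      (m := MeasurableSpace.comap (fun ω => (X 0 ω, T 0 ω)) inferInstance) hbdd, hce] with ω h1 h2
    rw [show g (X 0 ω, T 0 ω) = _ from h2]
    exact h1
  have hmain := measure_bernsteinTerm_lt_le (μ := μ) (W := fun i ω => g (X i ω, T i ω))
    (fun i => hg.comp ((h.measurable_X i).prodMk (h.measurable_T i)))
    (h.indep.comp (fun _ => g') fun _ => hg')
    (fun i => (h.identDistrib i).comp hg') hL hvar hN hn hδ hδ1
  rw [h.integral_phi_denoisedScore hη ρ D π] at hmain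
  convert! hmain using 6
  rw [cvEstimator, ← Fin.sum_univ_eq_sum_range]
  rfl

theorem measure_exists_bernsteinTerm_lt_le (h : IsModel μ X T Y e A B η L) (hη : 0 < η)
    (ρ : Fin k → ℝ) (D : Fin 2 → Fin s → ℝ) {Pol : Finset (Policy p)} (hne : Pol.Nonempty)
    (hbdd : ∀ π ∈ Pol, ∀ᵐ ω ∂μ,
      |phi e B D (observedScore ρ) π (observed X T Y 0 ω)| ≤ L) {δ : ℝ}
    {n : ℕ} (hn : 1 ≤ n) (hδ : 0 < δ) (hδ1 : δ < 1) :
    μ {ω | ∃ π ∈ Pol, bernsteinTerm Pol.card n δ (⨆ π : {π // π ∈ Pol},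
      Var[fun ω => phi e B D (observedScore ρ) π.1 (observed X T Y 0 ω); μ]) L <
        |cvEstimator ρ e A B B D (sample X T Y n ω) π - policyValue μ ρ X Y π|} ≤
      ENNReal.ofReal δ := by
  set v := ⨆ π : {π // π ∈ Pol},
    Var[fun ω => phi e B D (observedScore ρ) π.1 (observed X T Y 0 ω); μ]
  have hN : 1 ≤ Pol.card := hne.card_pos
  have hN0 : (0 : ℝ) < Pol.card := by exact_mod_cast hN
  have h1 : ∀ π ∈ Pol, μ {ω | bernsteinTerm Pol.card n δ v L <
      |cvEstimator ρ e A B B D (sample X T Y n ω) π - policyValue μ ρ X Y π|} ≤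
        ENNReal.ofReal (δ / Pol.card) := fun π hπ =>
    h.measure_bernsteinTerm_lt_cvEstimator_le hη ρ D π (hbdd π hπ)
      (le_ciSup (f := fun π : {π // π ∈ Pol} =>
        Var[fun ω => phi e B D (observedScore ρ) π.1 (observed X T Y 0 ω); μ])
        (Set.finite_range _).bddAbove ⟨π, hπ⟩) hN hn hδ hδ1
  have hset : {ω | ∃ π ∈ Pol, bernsteinTerm Pol.card n δ v L <
      |cvEstimator ρ e A B B D (sample X T Y n ω) π - policyValue μ ρ X Y π|} =
      ⋃ π ∈ Pol, {ω | bernsteinTerm Pol.card n δ v L <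
        |cvEstimator ρ e A B B D (sample X T Y n ω) π - policyValue μ ρ X Y π|} := by
    ext ω
    simp
  rw [hset]
  refine (measure_biUnion_finset_le _ _).trans ((Finset.sum_le_sum h1).trans (le_of_eq ?_))
  rw [Finset.sum_const, nsmul_eq_mul, ← ENNReal.ofReal_natCast, ← ENNReal.ofReal_mul hN0.le]
  congr 1
  field_simp

end IsModel

end RRPolicy

/-! ### Stochastic orders and empirical second moments. -/

namespace RRPolicy

section IsBigOP

variable {Ω : Type u} [MeasurableSpace Ω] {μ : Measure Ω} {a : ℕ → ℝ}

theorem IsBigOP.abs_add_abs {R S : ℕ → Ω → ℝ} (hR : IsBigOP μ R a) (hS : IsBigOP μ S a) :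
    IsBigOP μ (fun n ω => |R n ω| + |S n ω|) a := by
  intro ε hε
  obtain ⟨M, hM⟩ := hR (ε / 2) (by positivity)
  obtain ⟨M', hM'⟩ := hS (ε / 2) (by positivity)
  refine ⟨M + M', ?_⟩
  filter_upwards [hM, hM'] with n h1 h2
  have hsub : {ω | (M + M') * a n < |(|R n ω| + |S n ω|)|} ⊆
      {ω | M * a n < |R n ω|} ∪ {ω | M' * a n < |S n ω|} := by
    intro ω hω
    simp only [Set.mem_ofPred_eq, Set.mem_union] at hω ⊢
    rw [abs_of_nonneg (by positivity)] at hω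
    by_contra! hcon
    linarith
  refine (measure_mono hsub).trans ((measure_union_le _ _).trans ((add_le_add h1 h2).trans ?_))
  rw [← ENNReal.ofReal_add (by positivity) (by positivity), add_halves]

theorem isBigOP_zero : IsBigOP μ (fun _ _ => 0) a := by
  intro ε hε
  refine ⟨0, Eventually.of_forall fun n => ?_⟩
  simp

theorem IsBigOP.sum_abs {ι : Type*} {Z : ι → ℕ → Ω → ℝ} (I : Finset ι)
    (hZ : ∀ i ∈ I, IsBigOP μ (Z i) a) : IsBigOP μ (fun n ω => ∑ i ∈ I, |Z i n ω|) a := by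
  classical
  induction I using Finset.induction_on with
  | empty => simpa using isBigOP_zero
  | insert i I hi ih =>
    have h1 := (hZ i (Finset.mem_insert_self _ _)).abs_add_abs
      (ih fun j hj => hZ j (Finset.mem_insert_of_mem hj))
    convert! h1 using 3 with n ω
    rw [Finset.sum_insert hi, abs_of_nonneg (a := ∑ i ∈ I, |Z i n ω|)]
    exact Finset.sum_nonneg fun _ _ => abs_nonneg _

/-- Rates transfer through a domination that may fail on events of vanishing probability. -/
theorem IsBigOP.of_le_of_bad {R Z : ℕ → Ω → ℝ} (hZ : IsBigOP μ Z a) {bad : ℕ → Set Ω}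
    (hbad : Tendsto (fun n => μ (bad n)) atTop (𝓝 0)) {K : ℝ} (hK : 0 < K)
    (hle : ∀ n, 1 ≤ n → ∀ᵐ ω ∂μ, ω ∉ bad n → |R n ω| ≤ K * |Z n ω|) : IsBigOP μ R a := by
  intro ε hε
  obtain ⟨M, hM⟩ := hZ (ε / 2) (by positivity)
  refine ⟨K * M, ?_⟩
  have hb : ∀ᶠ n in atTop, μ (bad n) ≤ ENNReal.ofReal (ε / 2) :=
    (hbad.eventually_lt_const (by positivity)).mono fun _ h => h.le
  filter_upwards [hM, hb, eventually_ge_atTop 1] with n h1 h2 hn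
  have hsub : μ {ω | K * M * a n < |R n ω|} ≤ μ ({ω | M * a n < |Z n ω|} ∪ bad n) := by
    refine measure_mono_ae ?_
    filter_upwards [hle n hn] with ω hω hlt
    by_contra hcon
    obtain ⟨hcon1, hcon2⟩ := not_or.1 (show ¬(M * a n < |Z n ω| ∨ ω ∈ bad n) from hcon)
    have h3 := hω hcon2
    have h4 := mul_le_mul_of_nonneg_left (not_lt.1 hcon1) hK.le
    have h5 : K * M * a n < |R n ω| := hlt
    linarith
  refine hsub.trans ((measure_union_le _ _).trans ((add_le_add h1 h2).trans ?_))
  rw [← ENNReal.ofReal_add (by positivity) (by positivity), add_halves]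

/-- Chebyshev's inequality; the `+ 1` in the choice of `M` keeps it positive for zero variance. -/
theorem isBigOP_average [IsProbabilityMeasure μ] {Z : ℕ → Ω → ℝ}
    (hind : iIndepFun Z μ) (hid : ∀ i, IdentDistrib (Z i) (Z 0) μ μ) (h2 : MemLp (Z 0) 2 μ)
    (h0 : ∫ ω, Z 0 ω ∂μ = 0) :
    IsBigOP μ (fun n ω => (∑ i ∈ Finset.range n, Z i ω) / n) fun n => 1 / √(n : ℝ) := by
  intro ε hε
  have hV : 0 ≤ Var[Z 0; μ] := variance_nonneg _ _
  set M := √(Var[Z 0; μ] / ε) + 1 with hM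
  have hM0 : 0 < M := by positivity
  refine ⟨M, ?_⟩
  filter_upwards [eventually_ge_atTop 1] with n hn
  have hn0 : (0 : ℝ) < n := by exact_mod_cast hn
  have hmem : ∀ i, MemLp (Z i) 2 μ := fun i => (hid i).symm.memLp_snd h2
  have hS : MemLp (∑ i ∈ Finset.range n, Z i) 2 μ := memLp_finsetSum' _ fun i _ => hmem i
  have hvar : Var[∑ i ∈ Finset.range n, Z i; μ] = n * Var[Z 0; μ] := by
    rw [IndepFun.variance_sum (fun i _ => hmem i) fun i _ j _ hij => hind.indepFun hij]
    simp [fun i => (hid i).variance_eq]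
  have hmean : ∫ ω, (∑ i ∈ Finset.range n, Z i) ω ∂μ = 0 := by
    simp only [Finset.sum_apply]
    rw [integral_finsetSum _ fun i _ => (hmem i).integrable one_le_two]
    exact Finset.sum_eq_zero fun i _ => by rw [(hid i).integral_eq, h0]
  have hch := meas_ge_le_variance_div_sq hS (c := M * √n) (by positivity)
  rw [hmean, hvar] at hch
  have hsub : {ω | M * (1 / √(n : ℝ)) < |(∑ i ∈ Finset.range n, Z i ω) / n|} ⊆
      {ω | M * √n ≤ |(∑ i ∈ Finset.range n, Z i) ω - 0|} := by
    intro ω hω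
    simp only [Set.mem_ofPred_eq, Finset.sum_apply, sub_zero, abs_div, abs_of_pos hn0] at hω ⊢
    rw [lt_div_iff₀ hn0] at hω
    refine le_trans (le_of_eq ?_) hω.le
    rw [mul_assoc, one_div, ← div_eq_inv_mul, Real.div_sqrt]
  refine (measure_mono hsub).trans (hch.trans (ENNReal.ofReal_le_ofReal ?_))
  rw [mul_pow, Real.sq_sqrt hn0.le, mul_comm (M ^ 2), mul_div_mul_left _ _ hn0.ne',
    div_le_iff₀ (by positivity)]
  have hs : √(Var[Z 0; μ] / ε) ^ 2 = Var[Z 0; μ] / ε := Real.sq_sqrt (by positivity)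
  have hM2 : Var[Z 0; μ] / ε ≤ M ^ 2 := by
    rw [← hs, hM]
    gcongr
    linarith
  rw [div_le_iff₀ hε] at hM2
  linarith

end IsBigOP

/-- The quadratic form `∑ w_a w_b F_{ab}`. -/
def quad {p : ℕ} (w : EuclideanSpace ℝ (Fin p)) (F : Fin p → Fin p → ℝ) : ℝ :=
  ∑ a, ∑ b, w a * w b * F a b

theorem abs_quad_le {p : ℕ} (w : EuclideanSpace ℝ (Fin p)) {F : Fin p → Fin p → ℝ} {κ : ℝ}
    (hF : ∀ a b, |F a b| ≤ κ) : |quad w F| ≤ κ * p * ‖w‖ ^ 2 := by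
  have h1 : |quad w F| ≤ κ * (∑ a, |w a|) ^ 2 := by
    rw [pow_two, Finset.sum_mul_sum, Finset.mul_sum]
    refine (Finset.abs_sum_le_sum_abs _ _).trans (Finset.sum_le_sum fun a _ => ?_)
    rw [Finset.mul_sum]
    refine (Finset.abs_sum_le_sum_abs _ _).trans (Finset.sum_le_sum fun b _ => ?_)
    rw [abs_mul, abs_mul, mul_comm]
    exact mul_le_mul_of_nonneg_right (hF a b) (by positivity)
  refine h1.trans ?_
  rcases Nat.eq_zero_or_pos p with hp | hp
  · subst hp
    simp
  · have hκ : 0 ≤ κ := (abs_nonneg _).trans (hF ⟨0, hp⟩ ⟨0, hp⟩)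
    rw [mul_assoc]
    gcongr
    rw [EuclideanSpace.norm_sq_eq]
    have := sq_sum_le_card_mul_sum_sq (s := Finset.univ) (f := fun a => |w a|)
    simpa using this

theorem quad_outer {p : ℕ} (w : EuclideanSpace ℝ (Fin p)) (x : Fin p → ℝ) (c : ℝ) :
    quad w (fun a b => c * (x a * x b)) = c * inner ℝ w (WithLp.toLp 2 x) ^ 2 := by
  rw [PiLp.inner_apply, pow_two, Finset.sum_mul_sum, Finset.mul_sum]
  refine Finset.sum_congr rfl fun a _ => ?_
  rw [Finset.mul_sum]
  refine Finset.sum_congr rfl fun b _ => ?_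
  simp
  ring

namespace IsModel

variable {Ω : Type u} [MeasurableSpace Ω] {μ : Measure Ω} [IsProbabilityMeasure μ] {p k s : ℕ}
  {X : ℕ → Ω → Fin p → ℝ} {T : ℕ → Ω → Fin 2} {Y : Fin 2 → ℕ → Ω → Fin k → ℝ}
  {e : Fin 2 → (Fin p → ℝ) → ℝ} {A : Fin 2 → Matrix (Fin k) (Fin s) ℝ}
  {B : Fin 2 → Matrix (Fin s) (Fin p) ℝ} {η L : ℝ}

omit [IsProbabilityMeasure μ] in
theorem memLp_covariate (h : IsModel μ X T Y e A B η L) (a : Fin p) :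
    MemLp (fun ω => X 0 ω a) 2 μ :=
  h.memLp_X.eval a

omit [IsProbabilityMeasure μ] in
theorem integrable_covariate_mul (h : IsModel μ X T Y e A B η L) (a b : Fin p) :
    Integrable (fun ω => X 0 ω a * X 0 ω b) μ :=
  (h.memLp_covariate a).integrable_mul (h.memLp_covariate b)

theorem integrable_inner_sq (h : IsModel μ X T Y e A B η L) (w : EuclideanSpace ℝ (Fin p)) :
    Integrable (fun ω => inner ℝ w (WithLp.toLp 2 (X 0 ω)) ^ 2) μ := by
  have : ∀ ω, inner ℝ w (WithLp.toLp 2 (X 0 ω)) ^ 2 =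
      quad w (fun a b => 1 * (X 0 ω a * X 0 ω b)) := fun ω => by rw [quad_outer, one_mul]
  simp only [this, quad, one_mul]
  exact integrable_finsetSum _ fun a _ => integrable_finsetSum _ fun b _ =>
    (h.integrable_covariate_mul a b).const_mul _

/-- The covariates live in a subspace on which their second-moment form is positive definite. -/
theorem exists_support_subspace (h : IsModel μ X T Y e A B η L) :
    ∃ (R : Submodule ℝ (EuclideanSpace ℝ (Fin p))) (c : ℝ), 0 < c ∧
      (∀ᵐ ω ∂μ, WithLp.toLp 2 (X 0 ω) ∈ R) ∧
      ∀ w ∈ R, c * ‖w‖ ^ 2 ≤ ∫ ω, inner ℝ w (WithLp.toLp 2 (X 0 ω)) ^ 2 ∂μ := by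
  -- `N` consists of the directions almost surely orthogonal to `X`, the kernel of the second-moment
  -- form. Its orthogonal complement is the subspace sought, so degenerate covariates are allowed.
  set N : Submodule ℝ (EuclideanSpace ℝ (Fin p)) :=
    { carrier := {w | ∀ᵐ ω ∂μ, inner ℝ w (WithLp.toLp 2 (X 0 ω)) = 0}
      add_mem' := fun {v w} hv hw => by
        change ∀ᵐ ω ∂μ, inner ℝ (v + w) (WithLp.toLp 2 (X 0 ω)) = 0
        filter_upwards [hv, hw] with ω h1 h2
        rw [inner_add_left, h1, h2, add_zero]
      zero_mem' := ae_of_all _ fun ω => inner_zero_left _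
      smul_mem' := fun c w hw => by
        change ∀ᵐ ω ∂μ, inner ℝ (c • w) (WithLp.toLp 2 (X 0 ω)) = 0
        filter_upwards [hw] with ω h1
        rw [real_inner_smul_left, h1, mul_zero] } with hN
  have hmemN : ∀ w, w ∈ N ↔ ∀ᵐ ω ∂μ, inner ℝ w (WithLp.toLp 2 (X 0 ω)) = 0 := fun w => Iff.rfl
  set q : EuclideanSpace ℝ (Fin p) → ℝ := fun w =>
    ∫ ω, inner ℝ w (WithLp.toLp 2 (X 0 ω)) ^ 2 ∂μ with hq
  have hqc : Continuous q := by
    have : q = fun w => ∑ a, ∑ b, w a * w b * ∫ ω, X 0 ω a * X 0 ω b ∂μ := by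
      funext w
      have h1 : ∀ ω, inner ℝ w (WithLp.toLp 2 (X 0 ω)) ^ 2 =
          quad w (fun a b => 1 * (X 0 ω a * X 0 ω b)) := fun ω => by rw [quad_outer, one_mul]
      simp only [hq, h1, quad, one_mul]
      rw [integral_finsetSum _ fun a _ => integrable_finsetSum _ fun b _ =>
        (h.integrable_covariate_mul a b).const_mul _]
      refine Finset.sum_congr rfl fun a _ => ?_
      rw [integral_finsetSum _ fun b _ => (h.integrable_covariate_mul a b).const_mul _]
      simp only [integral_const_mul]
    rw [this]
    fun_prop
  have hqs : ∀ (c : ℝ) w, q (c • w) = c ^ 2 * q w := fun c w => by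
    simp only [hq, real_inner_smul_left, mul_pow, integral_const_mul]
  have hpos : ∀ w ∈ Nᗮ, w ≠ 0 → 0 < q w := by
    intro w hw hw0
    refine lt_of_le_of_ne (integral_nonneg fun ω => sq_nonneg _) fun h0 => hw0 ?_
    have h1 := (integral_eq_zero_iff_of_nonneg (fun ω => sq_nonneg _)
      (h.integrable_inner_sq w)).1 h0.symm
    have h2 : w ∈ N := by
      rw [hmemN]
      filter_upwards [h1] with ω h3
      simpa using h3
    exact inner_self_eq_zero.1 ((Submodule.mem_orthogonal _ _).1 hw w h2)
  -- A finite basis of `N` reduces uncountably many null sets to finitely many.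
  have hX : ∀ᵐ ω ∂μ, WithLp.toLp 2 (X 0 ω) ∈ Nᗮ := by
    have hb : ∀ᵐ ω ∂μ, ∀ i, inner ℝ (stdOrthonormalBasis ℝ N i : EuclideanSpace ℝ (Fin p))
        (WithLp.toLp 2 (X 0 ω)) = 0 :=
      ae_all_iff.2 fun i => (hmemN _).1 (stdOrthonormalBasis ℝ N i).2
    filter_upwards [hb] with ω hω
    refine (Submodule.mem_orthogonal _ _).2 fun u hu => ?_
    have h1 := congrArg (Subtype.val) ((stdOrthonormalBasis ℝ N).sum_repr' ⟨u, hu⟩)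
    simp only [Submodule.coe_sum, Submodule.coe_smul] at h1
    rw [← h1, sum_inner]
    exact Finset.sum_eq_zero fun i _ => by rw [real_inner_smul_left, hω i, mul_zero]
  -- The constant is the minimum of the form on the unit sphere of `Nᗮ`; any positive number serves
  -- when that sphere is empty.
  have hK : IsCompact (Metric.sphere (0 : EuclideanSpace ℝ (Fin p)) 1 ∩ (Nᗮ : Set _)) :=
    (isCompact_sphere _ _).inter_right (Submodule.isClosed_orthogonal N)
  obtain ⟨c, hc, hcle⟩ : ∃ c : ℝ, 0 < c ∧ ∀ w ∈ Nᗮ, ‖w‖ = 1 → c ≤ q w := by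
    rcases (Metric.sphere (0 : EuclideanSpace ℝ (Fin p)) 1 ∩ (Nᗮ : Set _)).eq_empty_or_nonempty
      with hem | hne
    · refine ⟨1, one_pos, fun w hw hw1 => ?_⟩
      have : w ∈ Metric.sphere (0 : EuclideanSpace ℝ (Fin p)) 1 ∩ (Nᗮ : Set _) :=
        ⟨by simpa using hw1, hw⟩
      rw [hem] at this
      exact this.elim
    · obtain ⟨w₀, hw₀, hmin⟩ := hK.exists_isMinOn hne hqc.continuousOn
      refine ⟨q w₀, hpos w₀ hw₀.2 fun h0 => ?_, fun w hw hw1 => hmin ⟨by simpa using hw1, hw⟩⟩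
      have := hw₀.1
      rw [h0] at this
      simp at this
  refine ⟨Nᗮ, c, hc, hX, fun w hw => ?_⟩
  rcases eq_or_ne w 0 with rfl | hw0
  · simp
  · have hn : ‖w‖ ≠ 0 := norm_ne_zero_iff.2 hw0
    have h1 := hcle (‖w‖⁻¹ • w) (Nᗮ.smul_mem _ hw) (by
      rw [norm_smul, norm_inv, norm_norm, inv_mul_cancel₀ hn])
    rw [hqs, inv_pow, ← div_eq_inv_mul, le_div_iff₀ (by positivity)] at h1
    exact h1

/-- With probability tending to one, the empirical second-moment forms of both arms are bounded
below on the support subspace, and the empirical second moment is bounded above. -/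
theorem exists_gram_bound (h : IsModel μ X T Y e A B η L) (hη : 0 < η) :
    ∃ (R : Submodule ℝ (EuclideanSpace ℝ (Fin p))) (c Γ : ℝ), 0 < c ∧ 0 ≤ Γ ∧
      (∀ᵐ ω ∂μ, ∀ i, WithLp.toLp 2 (X i ω) ∈ R) ∧
      Tendsto (fun n : ℕ => μ {ω | ¬ ((∀ t, ∀ w ∈ R, c * ‖w‖ ^ 2 ≤
        (∑ i ∈ Finset.range n, ind (T i ω) t * inner ℝ w (WithLp.toLp 2 (X i ω)) ^ 2) / n) ∧
        (∑ i ∈ Finset.range n, ‖WithLp.toLp 2 (X i ω)‖ ^ 2) / n ≤ Γ)}) atTop (𝓝 0) := by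
  obtain ⟨R, c₀, hc₀, hR, hlow⟩ := h.exists_support_subspace
  -- All entries of both Gram matrices are collected in one vector, so a single strong law, needing
  -- only second moments of `X`, handles them together.
  set f : (Fin p → ℝ) × Fin 2 × (Fin 2 → Fin k → ℝ) → Fin 2 → Fin p → Fin p → ℝ :=
    fun z t a b => ind z.2.1 t * (z.1 a * z.1 b) with hf
  have hfm : Measurable f := by
    have := measurable_ind
    fun_prop
  set F : ℕ → Ω → Fin 2 → Fin p → Fin p → ℝ := fun i ω =>
    f (X i ω, T i ω, fun t => Y t i ω) with hF
  have hFi0 : ∀ t a b, Integrable (fun ω => F 0 ω t a b) μ := fun t a b =>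
    h.integrable_ind_mul t (h.integrable_covariate_mul a b)
  have hFi2 : ∀ t a, Integrable (fun ω => F 0 ω t a) μ := fun t a =>
    Integrable.of_eval fun b => hFi0 t a b
  have hFi1 : ∀ t, Integrable (fun ω => F 0 ω t) μ := fun t => Integrable.of_eval fun a => hFi2 t a
  have hFi : Integrable (F 0) μ := Integrable.of_eval fun t => hFi1 t
  have hFind : iIndepFun F μ := h.indep.comp (fun _ => f) fun _ => hfm
  have hFid : ∀ i, IdentDistrib (F i) (F 0) μ μ := fun i => (h.identDistrib i).comp hfm
  set G := ∫ ω, F 0 ω ∂μ with hG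
  have hGe : ∀ t a b, G t a b = ∫ ω, F 0 ω t a b ∂μ := fun t a b => by
    rw [hG, eval_integral fun t => hFi1 t, eval_integral fun a => hFi2 t a,
      eval_integral fun b => hFi0 t a b]
  have hlln := strong_law_ae F hFi (fun i j hij => hFind.indepFun hij) hFid
  have hFm : ∀ i, AEStronglyMeasurable (F i) μ := fun i =>
    ((hFid i).symm.integrable_snd hFi).aestronglyMeasurable
  have hEm : ∀ n : ℕ, AEStronglyMeasurable
      (fun ω => (n : ℝ)⁻¹ • ∑ i ∈ Finset.range n, F i ω) μ := fun n =>
    (Finset.aestronglyMeasurable_fun_sum (Finset.range n) fun i _ => hFm i).const_smul (n : ℝ)⁻¹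
  have htm := tendstoInMeasure_of_tendsto_ae hEm hlln
  rw [tendstoInMeasure_iff_norm] at htm
  set c := η * c₀ / 2 with hc
  -- By overlap, the population form of each arm is at least `η c₀ = 2c`. An entrywise error `κ`
  -- moves the form by at most `κ p ‖w‖² ≤ c ‖w‖²`, so half survives; the `+ 1` covers `p = 0`.
  set κ := c / (p + 1) with hκ
  have hc0 : 0 < c := by positivity
  have hκ0 : 0 < κ := by positivity
  refine ⟨R, c, ∑ t, ∑ a, (|G t a a| + κ), hc0, by positivity, ?_, ?_⟩
  · refine ae_all_iff.2 fun i => ?_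
    have hm : MeasurableSet {z : (Fin p → ℝ) × Fin 2 × (Fin 2 → Fin k → ℝ) |
        WithLp.toLp 2 z.1 ∈ R} := by
      have : Measurable fun z : (Fin p → ℝ) × Fin 2 × (Fin 2 → Fin k → ℝ) =>
        (WithLp.toLp 2 z.1 : EuclideanSpace ℝ (Fin p)) := by fun_prop
      exact this R.closed_of_finiteDimensional.measurableSet
    exact (h.identDistrib i).symm.ae_mem_snd hm hR
  · refine tendsto_of_tendsto_of_tendsto_of_le_of_le tendsto_const_nhds (htm κ hκ0)
      (fun _ => zero_le) fun n => measure_mono fun ω hω => ?_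
    simp only [Set.mem_ofPred_eq] at hω ⊢
    by_contra! hlt
    apply hω
    set E := (n : ℝ)⁻¹ • ∑ i ∈ Finset.range n, F i ω with hE
    have hEe : ∀ t a b, E t a b =
        (∑ i ∈ Finset.range n, ind (T i ω) t * (X i ω a * X i ω b)) / n := fun t a b => by
      simp [hE, hF, hf, div_eq_inv_mul]
    have hd : ∀ t a b, |E t a b - G t a b| ≤ κ := fun t a b =>
      ((norm_le_pi_norm _ b).trans ((norm_le_pi_norm _ a).trans
        (norm_le_pi_norm (E - G) t))).trans hlt.le
    constructor
    · intro t w hw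
      have h1 : (∑ i ∈ Finset.range n,
          ind (T i ω) t * inner ℝ w (WithLp.toLp 2 (X i ω)) ^ 2) / n = quad w (E t) := by
        simp only [← quad_outer, quad, hEe, Finset.sum_div]
        rw [Finset.sum_comm]
        refine Finset.sum_congr rfl fun a _ => ?_
        rw [Finset.sum_comm]
        refine Finset.sum_congr rfl fun b _ => ?_
        rw [Finset.mul_sum]
        exact Finset.sum_congr rfl fun i _ => by ring
      have h2 : quad w (G t) = ∫ ω, ind (T 0 ω) t * inner ℝ w (WithLp.toLp 2 (X 0 ω)) ^ 2 ∂μ := by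
        simp only [← quad_outer, quad, hGe]
        rw [integral_finsetSum _ fun a _ => integrable_finsetSum _ fun b _ =>
          (hFi0 t a b).const_mul _]
        refine Finset.sum_congr rfl fun a _ => ?_
        rw [integral_finsetSum _ fun b _ => (hFi0 t a b).const_mul _]
        simp only [integral_const_mul]
      have h3 : η * (c₀ * ‖w‖ ^ 2) ≤ quad w (G t) := by
        rw [h2, h.integral_ind_mul t (f := fun x => inner ℝ w (WithLp.toLp 2 x) ^ 2) (by
          simp only [PiLp.inner_apply]; fun_prop) (h.integrable_inner_sq w)]
        refine (mul_le_mul_of_nonneg_left (hlow w hw) hη.le).trans ?_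
        rw [← integral_const_mul]
        refine integral_mono ((h.integrable_inner_sq w).const_mul _)
          (h.integrable_propensity_mul hη t (h.integrable_inner_sq w)) fun ω => ?_
        exact mul_le_mul_of_nonneg_right (h.overlap t _).1 (sq_nonneg _)
      have h4 : quad w (E t) - quad w (G t) = quad w (fun a b => E t a b - G t a b) := by
        simp only [quad, ← Finset.sum_sub_distrib, mul_sub]
      have h5 := abs_quad_le w (hd t)
      rw [← h4] at h5
      have h6 : κ * p * ‖w‖ ^ 2 ≤ c * ‖w‖ ^ 2 := by
        gcongr
        rw [hκ, div_mul_eq_mul_div, div_le_iff₀ (by positivity)]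
        nlinarith
      rw [h1]
      have h7 := (abs_le.1 h5).1
      have h8 : η * (c₀ * ‖w‖ ^ 2) = 2 * (c * ‖w‖ ^ 2) := by rw [hc]; ring
      linarith
    · have h1 : (∑ i ∈ Finset.range n,
          ‖(WithLp.toLp 2 (X i ω) : EuclideanSpace ℝ (Fin p))‖ ^ 2) / n =
          ∑ t, ∑ a, E t a a := by
        simp only [hEe, EuclideanSpace.norm_sq_eq, Finset.sum_div, Real.norm_eq_abs, sq_abs]
        rw [Finset.sum_comm (s := Finset.univ (α := Fin 2)), Finset.sum_comm]
        refine Finset.sum_congr rfl fun a _ => ?_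
        rw [Finset.sum_comm]
        refine Finset.sum_congr rfl fun i _ => ?_
        rw [← Finset.sum_div, sum_fin_two_mul_ind (fun _ => X i ω a * X i ω a), pow_two]
      rw [h1]
      refine Finset.sum_le_sum fun t _ => Finset.sum_le_sum fun a _ => ?_
      have := (abs_le.1 (hd t a a)).2
      linarith [le_abs_self (G t a a)]

theorem isBigOP_average (h : IsModel μ X T Y e A B η L)
    {g : (Fin p → ℝ) × Fin 2 × (Fin 2 → Fin k → ℝ) → ℝ} (hg : Measurable g)
    (h2 : MemLp (fun ω => g (X 0 ω, T 0 ω, fun t => Y t 0 ω)) 2 μ)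
    (h0 : ∫ ω, g (X 0 ω, T 0 ω, fun t => Y t 0 ω) ∂μ = 0) :
    IsBigOP μ (fun n ω => (∑ i ∈ Finset.range n, g (X i ω, T i ω, fun t => Y t i ω)) / n)
      fun n => 1 / √(n : ℝ) :=
  RRPolicy.isBigOP_average (h.indep.comp (fun _ => g) fun _ => hg)
    (fun i => (h.identDistrib i).comp hg) h2 h0

/-- Averages of the policy-weighted control variates. -/
theorem isBigOP_controlVariate (h : IsModel μ X T Y e A B η L) (hη : 0 < η) (π : Policy p)
    (t : Fin 2) (a : Fin p) :
    IsBigOP μ (fun n ω => (∑ i ∈ Finset.range n,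
      π.prob t (X i ω) * ((1 - ind (T i ω) t / e t (X i ω)) * X i ω a)) / n)
      fun n => 1 / √(n : ℝ) := by
  let g : (Fin p → ℝ) × Fin 2 × (Fin 2 → Fin k → ℝ) → ℝ := fun z =>
    π.prob t z.1 * ((1 - ind z.2.1 t / e t z.1) * z.1 a)
  have hm : Measurable g := by
    have h1 := π.measurable_prob t
    have h2 := h.measurable_e t
    have h3 := measurable_ind t
    fun_prop
  have hmX := h.measurable_X 0
  have hmT := h.measurable_T 0
  have hmY : Measurable fun ω => fun t => Y t 0 ω :=
    measurable_pi_lambda _ fun t => h.measurable_Y t 0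
  have hf : Measurable fun x : Fin p → ℝ => π.prob t x * x a := by
    have h1 := π.measurable_prob t
    fun_prop
  have hfi : Integrable (fun ω => π.prob t (X 0 ω) * X 0 ω a) μ :=
    (h.integrable_covariate a).bdd_mul (c := 1)
      ((π.measurable_prob t).comp hmX).aestronglyMeasurable
      (ae_of_all _ fun _ => π.abs_prob_le_one _ _)
  refine h.isBigOP_average (g := g) hm ?_ ?_
  · refine (h.memLp_covariate a).of_le_mul (c := 1 + 1 / η)
      (hm.comp (hmX.prodMk (hmT.prodMk hmY))).aestronglyMeasurable (ae_of_all _ fun ω => ?_)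
    have he := h.overlap t (X 0 ω)
    have h1 : |1 - ind (T 0 ω) t / e t (X 0 ω)| ≤ 1 + 1 / η := by
      refine (abs_sub _ _).trans ?_
      rw [abs_one, abs_div, abs_of_pos (a := e t (X 0 ω)) (by linarith)]
      gcongr
      · exact abs_ind_le_one _ _
      · exact he.1
    simp only [g, Real.norm_eq_abs, abs_mul]
    calc _ ≤ 1 * ((1 + 1 / η) * |X 0 ω a|) :=
          mul_le_mul (π.abs_prob_le_one _ _) (by gcongr) (by positivity) zero_le_one
      _ = _ := one_mul _
  · obtain ⟨hi, he⟩ := h.integral_ind_div_mul hη t hf hfi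
    have h1 : ∀ ω, π.prob t (X 0 ω) * ((1 - ind (T 0 ω) t / e t (X 0 ω)) * X 0 ω a) =
        π.prob t (X 0 ω) * X 0 ω a -
          ind (T 0 ω) t / e t (X 0 ω) * (π.prob t (X 0 ω) * X 0 ω a) := fun ω => by ring
    simp only [g, h1]
    rw [integral_sub hfi hi, he, sub_self]

/-- Averages of covariates times outcome noise. -/
theorem isBigOP_noise (h : IsModel μ X T Y e A B η L) (hη : 0 < η) (t : Fin 2) (a : Fin p)
    (j : Fin k) :
    IsBigOP μ (fun n ω => (∑ i ∈ Finset.range n,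
      ind (T i ω) t * (X i ω a * (Y t i ω j - ((A t * B t) *ᵥ X i ω) j))) / n)
      fun n => 1 / √(n : ℝ) := by
  let g : (Fin p → ℝ) × Fin 2 × (Fin 2 → Fin k → ℝ) → ℝ := fun z =>
    ind z.2.1 t * (z.1 a * (z.2.2 t j - ((A t * B t) *ᵥ z.1) j))
  have hm : Measurable g := by
    have h2 := measurable_mulVec_apply (A t * B t) j
    have h3 := measurable_ind t
    fun_prop
  have hmX := h.measurable_X 0
  have hmT := h.measurable_T 0
  have hmY : Measurable fun ω => fun t => Y t 0 ω :=
    measurable_pi_lambda _ fun t => h.measurable_Y t 0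
  refine h.isBigOP_average (g := g) hm ?_ ?_
  · refine (h.memLp_covariate a).of_le_mul (c := 2 * L)
      (hm.comp (hmX.prodMk (hmT.prodMk hmY))).aestronglyMeasurable ?_
    filter_upwards [h.abs_noise_le t] with ω hω
    simp only [g, Real.norm_eq_abs, abs_mul]
    calc _ ≤ 1 * (|X 0 ω a| * (2 * L)) :=
          mul_le_mul (abs_ind_le_one _ _) (by gcongr; exact hω j) (by positivity) zero_le_one
      _ = _ := by ring
  · exact h.integral_ind_mul_noise hη t j (f := fun x => x a) (measurable_pi_apply a)
      (h.integrable_covariate a)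

end IsModel

end RRPolicy

/-! ### Deterministic bounds on the event of well-conditioned Gram forms. -/

namespace RRPolicy

theorem norm_toLp_le_sum_abs {p : ℕ} (z : Fin p → ℝ) :
    ‖(WithLp.toLp 2 z : EuclideanSpace ℝ (Fin p))‖ ≤ ∑ a, |z a| := by
  have h : (WithLp.toLp 2 z : EuclideanSpace ℝ (Fin p)) =
      ∑ a, z a • EuclideanSpace.basisFun (Fin p) ℝ a := by
    rw [← (EuclideanSpace.basisFun (Fin p) ℝ).sum_repr (WithLp.toLp 2 z)]
    simp
  rw [h]
  refine (norm_sum_le _ _).trans (Finset.sum_le_sum fun a _ => ?_)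
  rw [norm_smul, OrthonormalBasis.norm_eq_one, mul_one, Real.norm_eq_abs]

theorem inner_toLp_transpose_mulVec {p q : ℕ} (G : Matrix (Fin q) (Fin p) ℝ) (d : Fin q → ℝ)
    (x : Fin p → ℝ) :
    inner ℝ (WithLp.toLp 2 (Gᵀ *ᵥ d) : EuclideanSpace ℝ (Fin p)) (WithLp.toLp 2 x) =
      d ⬝ᵥ (G *ᵥ x) := by
  rw [EuclideanSpace.inner_toLp_toLp, Matrix.mulVec_transpose, dotProduct_mulVec, dotProduct_comm]
  simp

section Deterministic

variable {n p k r : ℕ} {S : Fin n → Obs p k} {R : Submodule ℝ (EuclideanSpace ℝ (Fin p))}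
  {c Γ L : ℝ}

/-- The zero fit is a competitor, so residuals are no larger than outcomes, and fitted values are
outcomes minus residuals. -/
theorem IsRRRFit.sum_sq_fit_le {Ah : Fin 2 → Matrix (Fin k) (Fin r) ℝ}
    {Bh : Fin 2 → Matrix (Fin r) (Fin p) ℝ} (hfit : IsRRRFit S Ah Bh)
    (hY : ∀ i j, |(S i).y j| ≤ L) (t : Fin 2) :
    ∑ i, ind (S i).t t * ∑ j, ((Ah t * Bh t) *ᵥ (S i).x) j ^ 2 ≤ 4 * (n * (k * L ^ 2)) := by
  have h1 := hfit t 0 0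
  have h2 : ∑ i, ind (S i).t t * ∑ j, ((Ah t * Bh t) *ᵥ (S i).x) j ^ 2 ≤
      2 * (∑ i, ind (S i).t t * ∑ j, ((S i).y j - ((Ah t * Bh t) *ᵥ (S i).x) j) ^ 2) +
      2 * ∑ i, ind (S i).t t * ∑ j, ((S i).y j) ^ 2 := by
    rw [Finset.mul_sum, Finset.mul_sum, ← Finset.sum_add_distrib]
    refine Finset.sum_le_sum fun i _ => ?_
    have : ∑ j, ((Ah t * Bh t) *ᵥ (S i).x) j ^ 2 ≤
        2 * (∑ j, ((S i).y j - ((Ah t * Bh t) *ᵥ (S i).x) j) ^ 2) +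
          2 * ∑ j, ((S i).y j) ^ 2 := by
      rw [Finset.mul_sum, Finset.mul_sum, ← Finset.sum_add_distrib]
      refine Finset.sum_le_sum fun j _ => ?_
      nlinarith [sq_nonneg (2 * (S i).y j - ((Ah t * Bh t) *ᵥ (S i).x) j)]
    refine (mul_le_mul_of_nonneg_left this (ind_nonneg _ _)).trans (le_of_eq ?_)
    ring
  have h3 : ∑ i, ind (S i).t t * ∑ j, ((S i).y j) ^ 2 ≤ n * (k * L ^ 2) := by
    have : ∀ i ∈ Finset.univ, ind (S i).t t * ∑ j, ((S i).y j) ^ 2 ≤ k * L ^ 2 := by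
      intro i _
      have h4 : ∑ j, ((S i).y j) ^ 2 ≤ k * L ^ 2 := by
        have : ∀ j ∈ Finset.univ, ((S i).y j) ^ 2 ≤ L ^ 2 := fun j _ => by
          rw [← sq_abs]
          gcongr
          exact hY i j
        simpa using Finset.sum_le_card_nsmul _ _ _ this
      calc _ ≤ 1 * ∑ j, ((S i).y j) ^ 2 := by
            refine mul_le_mul_of_nonneg_right (ind_le_one _ _) ?_
            exact Finset.sum_nonneg fun _ _ => sq_nonneg _
        _ ≤ _ := by rwa [one_mul]
    simpa using Finset.sum_le_card_nsmul _ _ _ this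
  simp only [Matrix.mul_zero, Matrix.zero_mulVec, Pi.zero_apply, sub_zero] at h1
  linarith

/-- The projected regression weights are bounded. -/
theorem norm_sq_starProjection_weight_le {ρ : Fin k → ℝ} {e : Fin 2 → (Fin p → ℝ) → ℝ}
    {Ah : Fin 2 → Matrix (Fin k) (Fin r) ℝ} {Bh : Fin 2 → Matrix (Fin r) (Fin p) ℝ}
    {Dh : Fin 2 → Fin r → ℝ} (hfit : IsRRRFit S Ah Bh)
    (hD : IsRegressionWeight ρ e Ah Bh S Dh) (hn : 1 ≤ n) (hc : 0 < c) (hΓ : 0 ≤ Γ)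
    (hR : ∀ i, WithLp.toLp 2 (S i).x ∈ R)
    (hlow : ∀ t, ∀ w ∈ R, c * ‖w‖ ^ 2 ≤
      (∑ i, ind (S i).t t * inner ℝ w (WithLp.toLp 2 (S i).x) ^ 2) / n)
    (htr : (∑ i, ‖(WithLp.toLp 2 (S i).x : EuclideanSpace ℝ (Fin p))‖ ^ 2) / n ≤ Γ)
    (hY : ∀ i j, |(S i).y j| ≤ L) (t : Fin 2) :
    ‖R.starProjection (WithLp.toLp 2 ((Bh t)ᵀ *ᵥ Dh t))‖ ^ 2 ≤
      4 * Γ * (4 * (ρ ⬝ᵥ ρ) * (k * L ^ 2) / c) / c := by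
  have hn0 : (0 : ℝ) < n := by exact_mod_cast hn
  have hρ : 0 ≤ ρ ⬝ᵥ ρ := Finset.sum_nonneg fun j _ => mul_self_nonneg _
  -- Covariates lie in `R`, so the data see a coefficient vector only through its projection to `R`;
  -- only that part is bounded.
  have hproj : ∀ (u : EuclideanSpace ℝ (Fin p)) (i : Fin n),
      inner ℝ (R.starProjection u) (WithLp.toLp 2 (S i).x) =
        inner ℝ u (WithLp.toLp 2 (S i).x) := fun u i => by
    rw [Submodule.inner_starProjection_left_eq_right,
      Submodule.starProjection_eq_self_iff.2 (hR i)]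
  set v := R.starProjection (WithLp.toLp 2 ((Ah t * Bh t)ᵀ *ᵥ ρ))
  set w := R.starProjection (WithLp.toLp 2 ((Bh t)ᵀ *ᵥ Dh t))
  have hv : ∀ i, inner ℝ v (WithLp.toLp 2 (S i).x) = denoisedScore ρ Ah Bh t (S i) := fun i => by
    rw [hproj, inner_toLp_transpose_mulVec, denoisedScore]
  have hw : ∀ i, inner ℝ w (WithLp.toLp 2 (S i).x) = Dh t ⬝ᵥ (Bh t *ᵥ (S i).x) := fun i => by
    rw [hproj, inner_toLp_transpose_mulVec]
  have hv1 : c * ‖v‖ ^ 2 ≤ 4 * (ρ ⬝ᵥ ρ) * (k * L ^ 2) := by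
    refine (hlow t v (Submodule.starProjection_apply_mem _ _)).trans ?_
    rw [div_le_iff₀ hn0]
    calc _ ≤ ∑ i, (ρ ⬝ᵥ ρ) * (ind (S i).t t * ∑ j, ((Ah t * Bh t) *ᵥ (S i).x) j ^ 2) := by
          refine Finset.sum_le_sum fun i _ => ?_
          rw [hv, mul_left_comm]
          have h5 : denoisedScore ρ Ah Bh t (S i) ^ 2 ≤
              (ρ ⬝ᵥ ρ) * ∑ j, ((Ah t * Bh t) *ᵥ (S i).x) j ^ 2 := by
            refine (Finset.sum_mul_sq_le_sq_mul_sq Finset.univ ρ _).trans (le_of_eq ?_)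
            simp [dotProduct, pow_two]
          exact mul_le_mul_of_nonneg_left h5 (ind_nonneg _ _)
      _ ≤ (ρ ⬝ᵥ ρ) * (4 * (n * (k * L ^ 2))) := by
          rw [← Finset.mul_sum]
          exact mul_le_mul_of_nonneg_left (hfit.sum_sq_fit_le hY t) hρ
      _ = _ := by ring
  have hu : ∑ i, denoisedScore ρ Ah Bh t (S i) ^ 2 ≤ ‖v‖ ^ 2 * (Γ * n) := by
    rw [div_le_iff₀ hn0] at htr
    refine le_trans ?_ (mul_le_mul_of_nonneg_left htr (sq_nonneg _))
    rw [Finset.mul_sum]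
    refine Finset.sum_le_sum fun i _ => ?_
    rw [← hv, ← mul_pow, ← sq_abs]
    gcongr
    exact abs_real_inner_le_norm _ _
  -- On units of the other arm the indicator in `C_t` vanishes and `C_t = B̂_t X`. Comparing the
  -- least-squares weight with `0` therefore bounds `⟨w, X_i⟩²` summed over that arm, whose Gram
  -- form is bounded below.
  obtain ⟨t', ht'⟩ : ∃ t' : Fin 2, t' ≠ t := exists_ne t
  have hw1 : c * ‖w‖ ^ 2 ≤ 4 * (‖v‖ ^ 2 * Γ) := by
    refine (hlow t' w (Submodule.starProjection_apply_mem _ _)).trans ?_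
    rw [div_le_iff₀ hn0]
    have h1 := hD t 0
    simp only [dotProduct_zero, sub_zero] at h1
    have h2 : ∑ i, ind (S i).t t' * inner ℝ w (WithLp.toLp 2 (S i).x) ^ 2 ≤
        2 * (∑ i, (denoisedScore ρ Ah Bh t (S i) - controlVariate e Bh t (S i) ⬝ᵥ Dh t) ^ 2) +
        2 * ∑ i, denoisedScore ρ Ah Bh t (S i) ^ 2 := by
      rw [Finset.mul_sum, Finset.mul_sum, ← Finset.sum_add_distrib]
      refine Finset.sum_le_sum fun i _ => ?_
      by_cases hi : (S i).t = t'
      · have h3 : controlVariate e Bh t (S i) ⬝ᵥ Dh t =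
            inner ℝ w (WithLp.toLp 2 (S i).x) := by
          rw [hw, controlVariate, hi, dotProduct_comm]
          simp [ind, ht']
        rw [h3, hi]
        simp only [ind, if_true, one_mul]
        nlinarith [sq_nonneg (2 * denoisedScore ρ Ah Bh t (S i) -
          inner ℝ w (WithLp.toLp 2 (S i).x))]
      · simp only [ind, hi, if_false, zero_mul]
        positivity
    linarith
  rw [le_div_iff₀ hc, mul_comm]
  have hv2 : ‖v‖ ^ 2 ≤ 4 * (ρ ⬝ᵥ ρ) * (k * L ^ 2) / c := by
    rw [le_div_iff₀ hc, mul_comm]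
    exact hv1
  refine hw1.trans ?_
  rw [mul_comm (‖v‖ ^ 2), ← mul_assoc]
  gcongr

/-- Effect of estimating the weights, in terms of averages of the control variates. -/
theorem abs_cvEstimator_sub_weights_le {s : ℕ} {ρ : Fin k → ℝ} {e : Fin 2 → (Fin p → ℝ) → ℝ}
    {Ah : Fin 2 → Matrix (Fin k) (Fin r) ℝ} {Bh : Fin 2 → Matrix (Fin r) (Fin p) ℝ}
    {Dh : Fin 2 → Fin r → ℝ} (hfit : IsRRRFit S Ah Bh)
    (hD : IsRegressionWeight ρ e Ah Bh S Dh) (hn : 1 ≤ n) (hc : 0 < c) (hΓ : 0 ≤ Γ)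
    (hR : ∀ i, WithLp.toLp 2 (S i).x ∈ R)
    (hlow : ∀ t, ∀ w ∈ R, c * ‖w‖ ^ 2 ≤
      (∑ i, ind (S i).t t * inner ℝ w (WithLp.toLp 2 (S i).x) ^ 2) / n)
    (htr : (∑ i, ‖(WithLp.toLp 2 (S i).x : EuclideanSpace ℝ (Fin p))‖ ^ 2) / n ≤ Γ)
    (hY : ∀ i j, |(S i).y j| ≤ L) (B : Fin 2 → Matrix (Fin s) (Fin p) ℝ)
    (D : Fin 2 → Fin s → ℝ) (π : Policy p) :
    |cvEstimator ρ e Ah Bh Bh Dh S π - cvEstimator ρ e Ah Bh B D S π| ≤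
      (√(4 * Γ * (4 * (ρ ⬝ᵥ ρ) * (k * L ^ 2) / c) / c) +
        ∑ t, ‖(WithLp.toLp 2 ((B t)ᵀ *ᵥ D t) : EuclideanSpace ℝ (Fin p))‖) *
      ∑ t, ∑ a, |(∑ i, π.prob t (S i).x *
        ((1 - ind (S i).t t / e t (S i).x) * (S i).x a)) / n| := by
  -- The estimator is linear in the coefficient vector `G_tᵀ D_t`, and `z t` is the vector it is
  -- paired with. Being a combination of covariates, `z t` lies in `R`, so the bound on the
  -- projected weight is enough.
  set z : Fin 2 → EuclideanSpace ℝ (Fin p) := fun t => ∑ i,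
    (π.prob t (S i).x * (1 - ind (S i).t t / e t (S i).x) / n) •
      (WithLp.toLp 2 (S i).x : EuclideanSpace ℝ (Fin p)) with hz
  have hza : ∀ t, z t = WithLp.toLp 2 fun a => (∑ i, π.prob t (S i).x *
      ((1 - ind (S i).t t / e t (S i).x) * (S i).x a)) / n := by
    intro t
    ext a
    simp only [hz, WithLp.ofLp_sum, Finset.sum_apply, WithLp.ofLp_smul, Pi.smul_apply, smul_eq_mul,
      Finset.sum_div]
    exact Finset.sum_congr rfl fun i _ => by ring
  have hzR : ∀ t, z t ∈ R := fun t =>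
    Submodule.sum_mem _ fun i _ => R.smul_mem _ (hR i)
  have hdiff : cvEstimator ρ e Ah Bh Bh Dh S π - cvEstimator ρ e Ah Bh B D S π =
      ∑ t, (inner ℝ (WithLp.toLp 2 ((Bh t)ᵀ *ᵥ Dh t)) (z t) -
        inner ℝ (WithLp.toLp 2 ((B t)ᵀ *ᵥ D t)) (z t)) := by
    simp only [cvEstimator, phi, ← sub_div, ← Finset.sum_sub_distrib, hz, inner_sum,
      real_inner_smul_right, inner_toLp_transpose_mulVec, Finset.sum_div]
    rw [Finset.sum_comm]
    refine Finset.sum_congr rfl fun t _ => Finset.sum_congr rfl fun i _ => ?_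
    simp only [controlVariate, dotProduct_smul, smul_eq_mul]
    ring
  rw [hdiff, Finset.mul_sum]
  refine (Finset.abs_sum_le_sum_abs _ _).trans (Finset.sum_le_sum fun t _ => ?_)
  have h1 : |inner ℝ (WithLp.toLp 2 ((Bh t)ᵀ *ᵥ Dh t)) (z t)| ≤
      √(4 * Γ * (4 * (ρ ⬝ᵥ ρ) * (k * L ^ 2) / c) / c) * ‖z t‖ := by
    rw [← Submodule.starProjection_eq_self_iff.2 (hzR t),
      ← Submodule.inner_starProjection_left_eq_right,
      Submodule.starProjection_eq_self_iff.2 (hzR t)]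
    refine (abs_real_inner_le_norm _ _).trans ?_
    gcongr
    exact Real.le_sqrt_of_sq_le
      (norm_sq_starProjection_weight_le hfit hD hn hc hΓ hR hlow htr hY t)
  have h2 : |inner ℝ (WithLp.toLp 2 ((B t)ᵀ *ᵥ D t)) (z t)| ≤
      (∑ t, ‖(WithLp.toLp 2 ((B t)ᵀ *ᵥ D t) : EuclideanSpace ℝ (Fin p))‖) * ‖z t‖ := by
    refine (abs_real_inner_le_norm _ _).trans ?_
    gcongr
    exact Finset.single_le_sum
      (f := fun t => ‖(WithLp.toLp 2 ((B t)ᵀ *ᵥ D t) : EuclideanSpace ℝ (Fin p))‖)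
      (fun _ _ => norm_nonneg _) (Finset.mem_univ t)
  have h3 := norm_toLp_le_sum_abs fun a => (∑ i, π.prob t (S i).x *
      ((1 - ind (S i).t t / e t (S i).x) * (S i).x a)) / n
  rw [← hza] at h3
  refine (abs_sub _ _).trans ((add_le_add h1 h2).trans ?_)
  rw [← add_mul]
  gcongr

theorem toEuclideanLin_armDesign_apply (t : Fin 2) (w : EuclideanSpace ℝ (Fin p)) (i : Fin n) :
    Matrix.toEuclideanLin (armDesign S t) w i =
      ind (S i).t t * inner ℝ w (WithLp.toLp 2 (S i).x) := by
  simp only [PiLp.inner_apply, Finset.mul_sum]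
  simp [Matrix.toEuclideanLin, Matrix.mulVec, dotProduct, armDesign, mul_assoc]

theorem toEuclideanLin_armNoise_apply (M : Matrix (Fin k) (Fin p) ℝ) (t : Fin 2)
    (v : EuclideanSpace ℝ (Fin k)) (i : Fin n) :
    Matrix.toEuclideanLin (armNoise S M t) v i =
      ind (S i).t t * ∑ j, ((S i).y j - (M *ᵥ (S i).x) j) * v j := by
  have : ∀ j, armNoise S M t i j = ind (S i).t t * ((S i).y j - (M *ᵥ (S i).x) j) := by
    intro j
    simp only [armNoise, Matrix.sub_apply, Matrix.mul_apply, armDesign, armOutcome,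
      Matrix.of_apply, Matrix.transpose_apply, Matrix.mulVec, dotProduct, Finset.mul_sum, mul_sub]
    congr 1
    exact Finset.sum_congr rfl fun a _ => by ring
  simp only [Matrix.toEuclideanLin, Matrix.toLpLin_apply, Matrix.mulVec, dotProduct, this,
    Finset.mul_sum, mul_assoc]

/-- The operator norm of the projected noise is controlled by covariate-noise averages. -/
theorem singVal_columnProj_armNoise_le (hn : 1 ≤ n) (hc : 0 < c)
    (hR : ∀ i, WithLp.toLp 2 (S i).x ∈ R)
    (hlow : ∀ t, ∀ w ∈ R, c * ‖w‖ ^ 2 ≤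
      (∑ i, ind (S i).t t * inner ℝ w (WithLp.toLp 2 (S i).x) ^ 2) / n)
    (M : Matrix (Fin k) (Fin p) ℝ) (t : Fin 2) :
    singVal (columnProj (armDesign S t) * armNoise S M t) 0 ≤
      √(n / c) * ∑ a, ∑ j, |(∑ i, ind (S i).t t *
        ((S i).x a * ((S i).y j - (M *ᵥ (S i).x) j))) / n| := by
  have hn0 : (0 : ℝ) < n := by exact_mod_cast hn
  set Z : Fin p → Fin k → ℝ := fun a j => ∑ i, ind (S i).t t *
        ((S i).x a * ((S i).y j - (M *ᵥ (S i).x) j)) with hZ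
  set ζ := ∑ a, ∑ j, |Z a j| with hζ
  have hζ0 : 0 ≤ ζ := Finset.sum_nonneg fun _ _ => Finset.sum_nonneg fun _ _ => abs_nonneg _
  have hζn : ∑ a, ∑ j, |Z a j / n| = ζ / n := by
    simp only [hζ, Finset.sum_div, abs_div, abs_of_pos hn0]
  rw [hζn]
  refine LinearMap.singularValues_zero_le_of_norm_apply_le _ (by positivity) fun v => ?_
  rw [toEuclideanLin_mul_apply, toEuclideanLin_columnProj]
  set Q := LinearMap.range (Matrix.toEuclideanLin (armDesign S t))
  set y := Matrix.toEuclideanLin (armNoise S M t) v with hy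
  -- The projected noise is the design applied to some `w₀`, and projecting `w₀` to `R` leaves those
  -- values unchanged.
  obtain ⟨w₀, hw₀⟩ : Q.starProjection y ∈ Q := Submodule.starProjection_apply_mem _ _
  set w := R.starProjection w₀ with hw
  have hwi : ∀ i, Q.starProjection y i = ind (S i).t t * inner ℝ w (WithLp.toLp 2 (S i).x) := by
    intro i
    rw [← hw₀, toEuclideanLin_armDesign_apply, hw, Submodule.inner_starProjection_left_eq_right,
      Submodule.starProjection_eq_self_iff.2 (hR i)]
  have hlw : c * n * ‖w‖ ^ 2 ≤ ‖Q.starProjection y‖ ^ 2 := by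
    have h1 := hlow t w (Submodule.starProjection_apply_mem _ _)
    rw [le_div_iff₀ hn0] at h1
    have h2 : ‖Q.starProjection y‖ ^ 2 =
        ∑ i, ind (S i).t t * inner ℝ w (WithLp.toLp 2 (S i).x) ^ 2 := by
      rw [EuclideanSpace.norm_sq_eq]
      refine Finset.sum_congr rfl fun i _ => ?_
      rw [hwi, Real.norm_eq_abs, sq_abs, mul_pow, pow_two (ind _ _), ind_mul_self]
    rw [h2]
    linarith
  -- With `P` the projection onto `Q`, `‖Py‖² = ⟨Py, y⟩` is a bilinear form in `w` and `v` whose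
  -- coefficients are the covariate-noise sums `Z`. Combined with `hlw`, one factor `‖Py‖` cancels.
  have hup : ‖Q.starProjection y‖ ^ 2 ≤ ‖w‖ * ‖v‖ * ζ := by
    have h1 : ‖Q.starProjection y‖ ^ 2 = inner ℝ (Q.starProjection y) y := by
      rw [← real_inner_self_eq_norm_sq, Submodule.inner_starProjection_left_eq_right,
        Submodule.starProjection_eq_self_iff.2 (Submodule.starProjection_apply_mem _ _),
        ← Submodule.inner_starProjection_left_eq_right]
    have h2 : inner ℝ (Q.starProjection y) y = ∑ a, ∑ j, w a * v j * Z a j := by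
      have h3 : ∀ i, inner ℝ (Q.starProjection y i) (y i) =
          ∑ a, ∑ j, w a * v j * (ind (S i).t t *
            ((S i).x a * ((S i).y j - (M *ᵥ (S i).x) j))) := by
        intro i
        rw [hwi, hy, toEuclideanLin_armNoise_apply, PiLp.inner_apply]
        simp only [RCLike.inner_apply, conj_trivial]
        rw [mul_mul_mul_comm, ind_mul_self, mul_comm (∑ j, _), Finset.sum_mul_sum, Finset.mul_sum]
        refine Finset.sum_congr rfl fun a _ => ?_
        rw [Finset.mul_sum]
        exact Finset.sum_congr rfl fun j _ => by ring
      rw [PiLp.inner_apply]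
      simp only [h3]
      rw [Finset.sum_comm]
      refine Finset.sum_congr rfl fun a _ => ?_
      rw [Finset.sum_comm]
      refine Finset.sum_congr rfl fun j _ => ?_
      rw [← Finset.mul_sum]
    rw [h1, h2, hζ, Finset.mul_sum]
    refine Finset.sum_le_sum fun a _ => ?_
    rw [Finset.mul_sum]
    refine Finset.sum_le_sum fun j _ => ?_
    refine (le_abs_self _).trans ?_
    rw [abs_mul, abs_mul]
    gcongr
    · exact PiLp.norm_apply_le w a
    · exact PiLp.norm_apply_le v j
  set N := ‖Q.starProjection y‖
  have hN0 : 0 ≤ N := norm_nonneg _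
  have hs : √(n / c) * (ζ / n) * ‖v‖ = ζ * ‖v‖ / √(c * n) := by
    have h1 : √(n / c) = n / √(c * n) := by
      rw [eq_div_iff (by positivity), ← Real.sqrt_mul (by positivity),
        show n / c * (c * n) = (n : ℝ) ^ 2 by field_simp, Real.sqrt_sq hn0.le]
    rw [h1]
    field_simp
  rw [hs, le_div_iff₀ (by positivity)]
  have h1 : √(c * n) * ‖w‖ ≤ N := by
    refine le_of_sq_le_sq ?_ hN0
    rw [mul_pow, Real.sq_sqrt (by positivity)]
    exact hlw
  rcases hN0.eq_or_lt with h0 | hpos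
  · rw [← h0, zero_mul]
    positivity
  · refine le_of_mul_le_mul_left ?_ hpos
    have h2 : 0 ≤ ‖v‖ * ζ := by positivity
    have h3 := mul_le_mul_of_nonneg_right h1 h2
    have h4 := mul_le_mul_of_nonneg_left hup (Real.sqrt_nonneg (c * n))
    nlinarith

theorem singVal_eq_zero_of_rank_le {a b r : ℕ} (M : Matrix (Fin a) (Fin b) ℝ) (hM : M.rank ≤ r)
    {j : ℕ} (hj : r ≤ j) : singVal M j = 0 := by
  rw [singVal, LinearMap.singularValues_eq_zero_iff_le_finrank_range]
  rw [Matrix.rank_eq_finrank_range_toLin M (PiLp.basisFun 2 ℝ (Fin a))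
      (PiLp.basisFun 2 ℝ (Fin b)), ← Matrix.toLpLin_eq_toLin] at hM
  exact hM.trans hj

/-- In a correctly specified model the prediction-error term is bounded by covariate-noise
averages. -/
theorem abs_rrrTerm_le {s : ℕ} {C₁ C₂ : ℝ} (hC₂ : 0 < C₂) (hn : 1 ≤ n) (hc : 0 < c)
    (hR : ∀ i, WithLp.toLp 2 (S i).x ∈ R)
    (hlow : ∀ t, ∀ w ∈ R, c * ‖w‖ ^ 2 ≤
      (∑ i, ind (S i).t t * inner ℝ w (WithLp.toLp 2 (S i).x) ^ 2) / n)
    {A : Fin 2 → Matrix (Fin k) (Fin s) ℝ} {B : Fin 2 → Matrix (Fin s) (Fin p) ℝ}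
    (hrank : ∀ t, (A t * B t).rank ≤ r) :
    |rrrTerm C₁ C₂ r A B S| ≤ √(2 * C₂ * r / c) *
      ∑ t, ∑ a, ∑ j, |(∑ i, ind (S i).t t *
        ((S i).x a * ((S i).y j - ((A t * B t) *ᵥ (S i).x) j))) / n| := by
  have hn0 : (0 : ℝ) < n := by exact_mod_cast hn
  -- Singular values are indexed from `0`, so index `r` is the first beyond a rank of at most `r`.
  have hz : ∀ t, ∑ j ∈ Finset.Ico r k, singVal (A t * B t * (armDesign S t)ᵀ) j ^ 2 = 0 := fun t =>
    Finset.sum_eq_zero fun j hj => by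
      rw [singVal_eq_zero_of_rank_le _ ((Matrix.rank_mul_le_left _ _).trans (hrank t))
        (Finset.mem_Ico.1 hj).1]
      simp
  set d : Fin 2 → ℝ := fun t =>
    singVal (columnProj (armDesign S t) * armNoise S (A t * B t) t) 0 with hd
  have hd0 : ∀ t, 0 ≤ d t := fun t => singVal_nonneg _ _
  rw [rrrTerm, abs_of_nonneg (by positivity)]
  simp only [hz, mul_zero, zero_add]
  rw [← Finset.mul_sum]
  set ζ : Fin 2 → ℝ := fun t => ∑ a, ∑ j, |(∑ i, ind (S i).t t *
        ((S i).x a * ((S i).y j - ((A t * B t) *ᵥ (S i).x) j))) / n|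
  have hdζ : ∀ t, d t ≤ √(n / c) * ζ t := fun t =>
    singVal_columnProj_armNoise_le hn hc hR hlow (A t * B t) t
  have h1 : √(∑ t, d t ^ 2) ≤ √(n / c) * ∑ t, ζ t := by
    rw [Finset.mul_sum]
    refine Real.sqrt_le_iff.2 ⟨Finset.sum_nonneg fun t _ => (hd0 t).trans (hdζ t), ?_⟩
    refine (Finset.sum_le_sum fun t _ => pow_le_pow_left₀ (hd0 t) (hdζ t) 2).trans ?_
    exact Finset.sum_sq_le_sq_sum_of_nonneg fun t _ => (hd0 t).trans (hdζ t)
  rw [Real.sqrt_mul (by positivity)]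
  calc _ ≤ √(2 / n) * (√(C₂ * r) * (√(n / c) * ∑ t, ζ t)) := by gcongr
    _ = √(2 / n) * √(C₂ * r) * √(n / c) * ∑ t, ζ t := by ring
    _ = _ := by
      rw [← Real.sqrt_mul (by positivity), ← Real.sqrt_mul (by positivity)]
      congr 2
      field_simp

end Deterministic

end RRPolicy

/-! ### The `n^{-1/2}` rates. -/

namespace RRPolicy

namespace IsModel

variable {Ω : Type u} [MeasurableSpace Ω] {μ : Measure Ω} [IsProbabilityMeasure μ] {p k s r : ℕ}
  {X : ℕ → Ω → Fin p → ℝ} {T : ℕ → Ω → Fin 2} {Y : Fin 2 → ℕ → Ω → Fin k → ℝ}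
  {e : Fin 2 → (Fin p → ℝ) → ℝ} {A : Fin 2 → Matrix (Fin k) (Fin s) ℝ}
  {B : Fin 2 → Matrix (Fin s) (Fin p) ℝ} {η L : ℝ}

omit [IsProbabilityMeasure μ] in
theorem ae_abs_outcome_le (h : IsModel μ X T Y e A B η L) :
    ∀ᵐ ω ∂μ, ∀ i t j, |Y t i ω j| ≤ L := by
  refine ae_all_iff.2 fun i => ae_all_iff.2 fun t => ?_
  have hm : MeasurableSet {z : (Fin p → ℝ) × Fin 2 × (Fin 2 → Fin k → ℝ) |
      ∀ j, |z.2.2 t j| ≤ L} := by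
    rw [Set.ofPred_forall]
    refine MeasurableSet.iInter fun j => measurableSet_le (by fun_prop) measurable_const
  exact (h.identDistrib i).symm.ae_mem_snd hm (h.bounded t)

/-- Estimating the control-variate weights has an effect of order `n^{-1/2}`. -/
theorem isBigOP_weight_estimation (h : IsModel μ X T Y e A B η L) (hη : 0 < η) (ρ : Fin k → ℝ)
    {Pol : Finset (Policy p)} (hne : Pol.Nonempty) (D : Fin 2 → Fin s → ℝ)
    {Ah : ℕ → Ω → Fin 2 → Matrix (Fin k) (Fin r) ℝ}
    {Bh : ℕ → Ω → Fin 2 → Matrix (Fin r) (Fin p) ℝ}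
    (hfit : ∀ n ω, IsRRRFit (sample X T Y n ω) (Ah n ω) (Bh n ω))
    {Dh : ℕ → Ω → Fin 2 → Fin r → ℝ}
    (hDh : ∀ n ω, IsRegressionWeight ρ e (Ah n ω) (Bh n ω) (sample X T Y n ω) (Dh n ω)) :
    IsBigOP μ (fun n ω => ⨆ π : {π // π ∈ Pol},
      |cvEstimator ρ e (Ah n ω) (Bh n ω) (Bh n ω) (Dh n ω) (sample X T Y n ω) π.1 -
        cvEstimator ρ e (Ah n ω) (Bh n ω) B D (sample X T Y n ω) π.1|)
      fun n => 1 / √(n : ℝ) := by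
  obtain ⟨R, c, Γ, hc, hΓ, hR, hbad⟩ := h.exists_gram_bound hη
  set K := √(4 * Γ * (4 * (ρ ⬝ᵥ ρ) * (k * L ^ 2) / c) / c) +
    ∑ t, ‖(WithLp.toLp 2 ((B t)ᵀ *ᵥ D t) : EuclideanSpace ℝ (Fin p))‖ with hK
  have hK0 : 0 ≤ K := by positivity
  -- Policies, arms and coordinates are finite in number, so the sum of all the averages keeps the
  -- rate and dominates the supremum over policies.
  have hZ := IsBigOP.sum_abs (μ := μ) (a := fun n : ℕ => 1 / √(n : ℝ))
    (Z := fun (q : Policy p × Fin 2 × Fin p) n ω => (∑ i ∈ Finset.range n,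
      q.1.prob q.2.1 (X i ω) * ((1 - ind (T i ω) q.2.1 / e q.2.1 (X i ω)) * X i ω q.2.2)) / n)
    (Pol ×ˢ Finset.univ ×ˢ Finset.univ) fun q _ => h.isBigOP_controlVariate hη q.1 q.2.1 q.2.2
  refine hZ.of_le_of_bad hbad (K := K + 1) (by positivity) fun n hn => ?_
  filter_upwards [hR, h.ae_abs_outcome_le] with ω hRω hYω hω
  obtain ⟨hlow, htr⟩ := not_not.1 hω
  simp only [Finset.sum_range] at hlow htr
  have hbound := fun π : Policy p => abs_cvEstimator_sub_weights_le (S := sample X T Y n ω)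
    (hfit n ω) (hDh n ω) hn hc hΓ (fun i => hRω i) hlow htr (fun i j => hYω i (T i ω) j) B D π
  have hne' : Nonempty {π // π ∈ Pol} := hne.to_subtype
  have h0 : ∀ π : Policy p, 0 ≤ ∑ t, ∑ a, |(∑ i : Fin n, π.prob t (X i ω) *
      ((1 - ind (T i ω) t / e t (X i ω)) * X i ω a)) / n| := fun π =>
    Finset.sum_nonneg fun _ _ => Finset.sum_nonneg fun _ _ => abs_nonneg _
  rw [abs_of_nonneg (Real.iSup_nonneg fun _ => abs_nonneg _)]
  simp only [Finset.sum_range, Finset.sum_product]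
  refine ciSup_le fun π => (hbound π.1).trans ?_
  refine mul_le_mul (le_add_of_nonneg_right zero_le_one) ?_ (h0 π.1) (by positivity)
  refine le_trans ?_ (le_abs_self _)
  exact Finset.single_le_sum (f := fun π : Policy p => ∑ t, ∑ a, |(∑ i : Fin n,
    π.prob t (X i ω) * ((1 - ind (T i ω) t / e t (X i ω)) * X i ω a)) / n|)
    (fun π _ => h0 π) π.2

/-- In a correctly specified model the prediction-error term is of order `n^{-1/2}`. -/
theorem isBigOP_rrrTerm (h : IsModel μ X T Y e A B η L) (hη : 0 < η) {C₁ C₂ : ℝ} (hC₂ : 0 < C₂)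
    (hrank : ∀ t, (A t * B t).rank ≤ r) :
    IsBigOP μ (fun n ω => rrrTerm C₁ C₂ r A B (sample X T Y n ω)) fun n => 1 / √(n : ℝ) := by
  obtain ⟨R, c, Γ, hc, hΓ, hR, hbad⟩ := h.exists_gram_bound hη
  have hZ := IsBigOP.sum_abs (μ := μ) (a := fun n : ℕ => 1 / √(n : ℝ))
    (Z := fun (q : Fin 2 × Fin p × Fin k) n ω => (∑ i ∈ Finset.range n, ind (T i ω) q.1 *
      (X i ω q.2.1 * (Y q.1 i ω q.2.2 - ((A q.1 * B q.1) *ᵥ X i ω) q.2.2))) / n)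
    (Finset.univ ×ˢ Finset.univ ×ˢ Finset.univ) fun q _ => h.isBigOP_noise hη q.1 q.2.1 q.2.2
  refine hZ.of_le_of_bad hbad (K := √(2 * C₂ * r / c) + 1) (by positivity) fun n hn => ?_
  filter_upwards [hR] with ω hRω hω
  obtain ⟨hlow, -⟩ := not_not.1 hω
  simp only [Finset.sum_range] at hlow
  have hbound := abs_rrrTerm_le (S := sample X T Y n ω) (C₁ := C₁) hC₂ hn hc (fun i => hRω i) hlow
    hrank
  -- Under the arm indicator the observed outcome is the potential outcome of that arm.
  have hnoise : ∀ (i : Fin n) (t : Fin 2) (a : Fin p) (j : Fin k), ind (T i ω) t *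
      (X i ω a * (Y (T i ω) i ω j - ((A t * B t) *ᵥ X i ω) j)) = ind (T i ω) t *
      (X i ω a * (Y t i ω j - ((A t * B t) *ᵥ X i ω) j)) := by
    intro i t a j
    by_cases hT : T i ω = t
    · rw [hT]
    · simp [ind, hT]
  simp only [sample, observed, hnoise] at hbound
  simp only [Finset.sum_range, Finset.sum_product]
  refine hbound.trans (mul_le_mul (le_add_of_nonneg_right zero_le_one) (le_abs_self _) ?_
    (by positivity))
  exact Finset.sum_nonneg fun _ _ => Finset.sum_nonneg fun _ _ => Finset.sum_nonneg fun _ _ =>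
    abs_nonneg _

end IsModel

end RRPolicy

/-! ### The generalization error theorem. -/

theorem mainTheorem1 {k : ℕ} (ρ : Fin k → ℝ) (η : ℝ) (hη : 0 < η) :
    ∃ C₁ C₂ : ℝ, 0 < C₁ ∧ 0 < C₂ ∧
    ∀ {Ω : Type u} [MeasurableSpace Ω] (μ : Measure Ω) [IsProbabilityMeasure μ]
      {p s r : ℕ} (X : ℕ → Ω → Fin p → ℝ) (T : ℕ → Ω → Fin 2) (Y : Fin 2 → ℕ → Ω → Fin k → ℝ)
      (e : Fin 2 → (Fin p → ℝ) → ℝ) (A : Fin 2 → Matrix (Fin k) (Fin s) ℝ)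
      (B : Fin 2 → Matrix (Fin s) (Fin p) ℝ) (L : ℝ)
      (_hmodel : RRPolicy.IsModel μ X T Y e A B η L)
      -- the policy class and its optimal policy (outcomes are losses)
      (Pol : Finset (RRPolicy.Policy p)) (πstar : RRPolicy.Policy p) (_hstar : πstar ∈ Pol)
      (_hopt : ∀ π ∈ Pol,
        RRPolicy.policyValue μ ρ X Y πstar ≤ RRPolicy.policyValue μ ρ X Y π)
      -- the (arbitrary) population weights, for example the variance-minimizing ones
      (Dstar : Fin 2 → Fin s → ℝ)
      (_hbdd : ∀ π ∈ Pol, ∀ᵐ ω ∂μ,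
        |RRPolicy.phi e B Dstar (RRPolicy.observedScore ρ) π
          (RRPolicy.observed X T Y 0 ω)| ≤ L)
      -- the reduced-rank regression fits and the estimated regression weights
      (Ahat : ℕ → Ω → Fin 2 → Matrix (Fin k) (Fin r) ℝ)
      (Bhat : ℕ → Ω → Fin 2 → Matrix (Fin r) (Fin p) ℝ)
      (_hfit : ∀ n ω, RRPolicy.IsRRRFit (RRPolicy.sample X T Y n ω) (Ahat n ω) (Bhat n ω))
      (Dhat : ℕ → Ω → Fin 2 → Fin r → ℝ)
      (_hDhat : ∀ n ω, RRPolicy.IsRegressionWeight ρ e (Ahat n ω) (Bhat n ω)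
        (RRPolicy.sample X T Y n ω) (Dhat n ω)),
      let V : RRPolicy.Policy p → ℝ := RRPolicy.policyValue μ ρ X Y
      -- the denoised control-variate estimator with weights `Dstar`, and with weights `Dhat`
      let Vstar : ℕ → Ω → RRPolicy.Policy p → ℝ := fun n ω =>
        RRPolicy.cvEstimator ρ e (Ahat n ω) (Bhat n ω) B Dstar (RRPolicy.sample X T Y n ω)
      let Vhat : ℕ → Ω → RRPolicy.Policy p → ℝ := fun n ω =>
        RRPolicy.cvEstimator ρ e (Ahat n ω) (Bhat n ω) (Bhat n ω) (Dhat n ω)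
          (RRPolicy.sample X T Y n ω)
      let bern : ℕ → ℝ → ℝ := fun n δ =>
        RRPolicy.bernsteinTerm Pol.card n δ
          (⨆ π : {π // π ∈ Pol}, Var[fun ω => RRPolicy.phi e B Dstar (RRPolicy.observedScore ρ)
            π.1 (RRPolicy.observed X T Y 0 ω); μ]) L
      let rrr : ℕ → Ω → ℝ := fun n ω =>
        RRPolicy.rrrTerm C₁ C₂ r A B (RRPolicy.sample X T Y n ω)
      -- the effect of using the estimated weights
      let Δ : ℕ → Ω → ℝ := fun n ω => ⨆ π : {π // π ∈ Pol}, |Vhat n ω π.1 - Vstar n ω π.1|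
      (∀ πhat : ℕ → Ω → RRPolicy.Policy p,
        (∀ n ω, πhat n ω ∈ Pol ∧ ∀ π ∈ Pol, Vstar n ω (πhat n ω) ≤ Vstar n ω π) →
        ∀ n : ℕ, 1 ≤ n → ∀ δ : ℝ, 0 < δ → δ < 1 →
          μ {ω | ¬ (|Vstar n ω (πhat n ω) - V πstar| ≤ bern n δ + rrr n ω ∧
              V (πhat n ω) - V πstar ≤ 2 * (bern n δ + rrr n ω))} ≤ ENNReal.ofReal δ) ∧
      (∀ πhat : ℕ → Ω → RRPolicy.Policy p,
        (∀ n ω, πhat n ω ∈ Pol ∧ ∀ π ∈ Pol, Vhat n ω (πhat n ω) ≤ Vhat n ω π) →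
        ∀ n : ℕ, 1 ≤ n → ∀ δ : ℝ, 0 < δ → δ < 1 →
          μ {ω | ¬ (|Vhat n ω (πhat n ω) - V πstar| ≤ bern n δ + rrr n ω + Δ n ω ∧
              V (πhat n ω) - V πstar ≤ 2 * (bern n δ + rrr n ω + Δ n ω))} ≤ ENNReal.ofReal δ) ∧
      RRPolicy.IsBigOP μ Δ (fun n => 1 / √(n : ℝ)) ∧
      ((∀ t, (A t * B t).rank ≤ r) →
        RRPolicy.IsBigOP μ rrr (fun n => 1 / √(n : ℝ))) := by
  have hρ : 0 ≤ ρ ⬝ᵥ ρ := Finset.sum_nonneg fun j _ => mul_self_nonneg _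
  have hC : 0 < (ρ ⬝ᵥ ρ + 1) / (2 * η ^ 2) := by positivity
  -- The `3` and `16` come from the oracle inequality, the common factor from Cauchy-Schwarz with
  -- `ρ` and overlap.
  refine ⟨3 * ((ρ ⬝ᵥ ρ + 1) / (2 * η ^ 2)), 16 * ((ρ ⬝ᵥ ρ + 1) / (2 * η ^ 2)), by positivity,
    by positivity, ?_⟩
  intro Ω _ μ _ p s r X T Y e A B L h Pol πstar hstar hopt Dstar hbdd Ahat Bhat hfit Dhat hDhat
    V Vstar Vhat bern rrr Δ
  have hne : Pol.Nonempty := ⟨πstar, hstar⟩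
  -- This holds for every `ω` and so costs no probability; the Bernstein failure is the only
  -- exceptional event, shared by all conclusions of the first two claims.
  have hdenoise : ∀ n, 1 ≤ n → ∀ ω π, |Vstar n ω π - RRPolicy.cvEstimator ρ e A B B Dstar
      (RRPolicy.sample X T Y n ω) π| ≤ rrr n ω := fun n hn ω π =>
    RRPolicy.abs_cvEstimator_sub_le hη (fun t x => (h.overlap t x).1) (hfit n ω) A B Dstar π hn
  have hΔ : ∀ n ω, ∀ π ∈ Pol, |Vhat n ω π - Vstar n ω π| ≤ Δ n ω := fun n ω π hπ =>
    le_ciSup (f := fun π : {π // π ∈ Pol} => |Vhat n ω π.1 - Vstar n ω π.1|)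
      (Set.finite_range _).bddAbove ⟨π, hπ⟩
  have hbern := fun (n : ℕ) (hn : 1 ≤ n) (δ : ℝ) (hδ : 0 < δ) (hδ1 : δ < 1) =>
    h.measure_exists_bernsteinTerm_lt_le hη ρ Dstar hne hbdd hn hδ hδ1
  refine ⟨?_, ?_, h.isBigOP_weight_estimation hη ρ hne Dstar hfit hDhat,
    fun hrank => h.isBigOP_rrrTerm hη (by positivity) hrank⟩
  · intro πhat hπhat n hn δ hδ hδ1
    refine (measure_mono fun ω hω => ?_).trans (hbern n hn δ hδ hδ1)
    by_contra hcon
    simp only [Set.mem_ofPred_eq, not_exists, not_and, not_lt] at hcon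
    refine hω (RRPolicy.minimizer_generalization (fun π hπ => ?_) hstar hopt (hπhat n ω).1
      (hπhat n ω).2)
    refine (abs_sub_le _ (RRPolicy.cvEstimator ρ e A B B Dstar
      (RRPolicy.sample X T Y n ω) π) _).trans ?_
    rw [add_comm]
    exact add_le_add (hcon π hπ) (hdenoise n hn ω π)
  · intro πhat hπhat n hn δ hδ hδ1
    refine (measure_mono fun ω hω => ?_).trans (hbern n hn δ hδ hδ1)
    by_contra hcon
    simp only [Set.mem_ofPred_eq, not_exists, not_and, not_lt] at hcon
    refine hω (RRPolicy.minimizer_generalization (fun π hπ => ?_) hstar hopt (hπhat n ω).1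
      (hπhat n ω).2)
    refine (abs_sub_le _ (Vstar n ω π) _).trans ?_
    rw [add_comm]
    refine add_le_add ?_ (hΔ n ω π hπ)
    refine (abs_sub_le _ (RRPolicy.cvEstimator ρ e A B B Dstar
      (RRPolicy.sample X T Y n ω) π) _).trans ?_
    rw [add_comm]
    exact add_le_add (hcon π hπ) (hdenoise n hn ω π)
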